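/- Let $\delta\ge 1$ be an integer and $\tau\in\mathbb C$ with $\operatorname{Im}\tau>0$. Let $V=\mathbb C$, $\lambda_1=\delta$, $\lambda_2=\tau$, $\Lambda=\mathbb Z\lambda_1+\mathbb Z\lambda_2$, and $M=V/\Lambda$. For a holomorphic line bundle $L$ on the quotient of a complex vector space $W$ by a lattice generated by $a_1,\dots,a_r$, with projection $\pi$, functions $e_{a_1},\dots,e_{a_r}$ on $W$ are called a system of multipliers of $L$ if there is a holomorphic trivialization $\varphi:\pi^*L\to W\times\mathbb C$ with $\varphi_{w+a_k}=e_{a_k}(w)\,\varphi_w$ on $L_{\pi(w+a_k)}=L_{\pi(w)}$ for all $k$ and all $w\in W$. Let $L_0$ be the holomorphic line bundle on $M$ with multipliers $e_{\lambda_1}(z)\equiv 1$, $e_{\lambda_2}(z)=e^{-2\pi i z-\pi i\tau}$. Let $\overline V^{\,*}$ be the space of conjugate linear functionals on $V$, let $\overline\Lambda^{\,*}\subset\overline V^{\,*}$ be the lattice of those functionals whose real part is half-integral on $\Lambda$, and let $\widehat M=\mathrm{Pic}^0(M)=\overline V^{\,*}/\overline\Lambda^{\,*}$, where $[\alpha]\in\widehat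 M$ corresponds to the line bundle $\mathrm P_\alpha$ on $M$ with the constant multipliers $e_\lambda=e^{2\pi i\alpha(\lambda)}$, $\lambda\in\Lambda$. Let $\varphi_{L_0}:M\to\widehat M$ be the holomorphic map induced by the complex linear map $V\to\overline V^{\,*}$, $\mu\mapsto\mu e_1^*$, with $e_1^*(z)=\frac{-i}{2\operatorname{Im}\tau}\,\bar z$. A Poincaré line bundle is a holomorphic line bundle $\mathrm P$ on $M\times\widehat M$ with $\mathrm P|_{M\times\{[\alpha]\}}\cong\mathrm P_\alpha$ for all $\alpha\in\overline V^{\,*}$ and with $\mathrm P|_{\{0\}\times\widehat M}$ holomorphically trivial. Then $\varphi_{L_0}$ is the classifying map $[\mu]\mapsto \mathcal T_\mu^*L_0\otimes L_0^*$, where $\mathcal T_\mu$ is the translation of $M$ by $[\mu]$ (that is, $\mathcal T_\mu^*L_0\otimes L_0^*\cong \mathrm P_\alpha$ whenever $[\alpha]=\varphi_{L_0}([\mu])$), a Poincaré line bundle exists, and for every Poincaré line bundle $\mathrm P$ the following holds. Write $\lambda_{10}=(\lambda_1,0)$, $\lambda_{20}=(\lambda_2,0)$, $\lambda_{01}=(0,\lambda_1)$,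 $\lambda_{02}=(0,\lambda_2)$ for the generators of $\Lambda\times\Lambda\subset V\times V$, let $(z,\mu)$ be the coordinates of $V\times V$, and let $\pi_1,\pi_2:M\times M\to M$ be the projections. The holomorphic line bundle $$\widetilde K=\pi_1^*L_0\otimes(\mathrm{Id}\times\varphi_{L_0})^*\mathrm P\otimes\pi_2^*L_0$$ on $M\times M=(V\times V)/(\Lambda\times\Lambda)$ has the system of multipliers $$e_{\lambda_{10}}(z,\mu)\equiv 1,\quad e_{\lambda_{01}}(z,\mu)\equiv 1,\quad e_{\lambda_{20}}(z,\mu)=e_{\lambda_{02}}(z,\mu)=e^{-2\pi i z-2\pi i\mu-\pi i\tau},$$ and $(\mathrm{Id}\times\varphi_{L_0})^*\mathrm P$ has the system of multipliers $$e_{\lambda_{10}}(z,\mu)\equiv 1,\quad e_{\lambda_{20}}(z,\mu)=e^{-2\pi i\mu},\quad e_{\lambda_{01}}(z,\mu)\equiv 1,\quad e_{\lambda_{02}}(z,\mu)=e^{-2\pi i z}.$$ -/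

import Mathlib

open scoped Manifold ContDiff Topology TensorProduct ComplexConjugate
open Bundle

set_option linter.unusedSectionVars false

noncomputable section

/-! ### Holomorphic line bundles -/

/-- A holomorphic line bundle over `X`: a Mathlib vector bundle with model fibre `ℂ`
whose transition functions are complex analytic. -/
structure HolLineBundle {E H : Type} [NormedAddCommGroup E] [NormedSpace ℂ E] [TopologicalSpace H]
    (I : ModelWithCorners ℂ E H) (X : Type) [TopologicalSpace X] [ChartedSpace H X] where
  Fiber : X → Type
  [addCommGroup : ∀ x, AddCommGroup (Fiber x)]
  [module : ∀ x, Module ℂ (Fiber x)]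
  [fiberTop : ∀ x, TopologicalSpace (Fiber x)]
  [totalTop : TopologicalSpace (TotalSpace ℂ Fiber)]
  [fiberBundle : FiberBundle ℂ Fiber]
  [vectorBundle : VectorBundle ℂ ℂ Fiber]
  [holomorphic : ContMDiffVectorBundle ω ℂ Fiber I]

namespace HolLineBundle

attribute [instance] addCommGroup module fiberTop totalTop fiberBundle vectorBundle holomorphic

variable {E H : Type} [NormedAddCommGroup E] [NormedSpace ℂ E] [TopologicalSpace H]
  {I : ModelWithCorners ℂ E H} {X : Type} [TopologicalSpace X] [ChartedSpace H X]
  {E' H' : Type} [NormedAddCommGroup E'] [NormedSpace ℂ E'] [TopologicalSpace H']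
  {I' : ModelWithCorners ℂ E' H'} {Y : Type} [TopologicalSpace Y] [ChartedSpace H' Y]

/-- Data of local frames on a family of lines `N x`: on the open set `U i` the line `N x` is
spanned by `frame i x`, with coordinate `coord i x`, and changes of frame are holomorphic. -/
structure LocalFrames (I : ModelWithCorners ℂ E H) (N : X → Type)
    [∀ x, AddCommGroup (N x)] [∀ x, Module ℂ (N x)] where
  ι : Type
  U : ι → Set X
  isOpen_U : ∀ i, IsOpen (U i)
  idx : X → ι
  mem_idx : ∀ x, x ∈ U (idx x)
  coord : ∀ (_ : ι) (x : X), N x →ₗ[ℂ] ℂ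
  frame : ∀ (_ : ι) (x : X), N x
  coord_frame : ∀ i, ∀ x ∈ U i, coord i x (frame i x) = 1
  coord_smul_frame : ∀ i, ∀ x ∈ U i, ∀ v, coord i x v • frame i x = v
  holo : ∀ i j, ContMDiffOn I 𝓘(ℂ, ℂ) ω (fun x => coord j x (frame i x)) (U i ∩ U j)

namespace LocalFrames

variable {N : X → Type} [∀ x, AddCommGroup (N x)] [∀ x, Module ℂ (N x)] (A : LocalFrames I N)

def pretriv (i : A.ι) : Pretrivialization ℂ (π ℂ N) where
  toFun v := (v.1, A.coord i v.1 v.2)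
  invFun q := ⟨q.1, q.2 • A.frame i q.1⟩
  source := π ℂ N ⁻¹' A.U i
  target := A.U i ×ˢ Set.univ
  map_source' v hv := ⟨hv, Set.mem_univ _⟩
  map_target' q hq := hq.1
  left_inv' := by
    rintro ⟨x, v⟩ hx
    simp only [TotalSpace.mk_inj]
    exact A.coord_smul_frame i x hx v
  right_inv' := by
    rintro ⟨x, c⟩ ⟨hx, -⟩
    simp [A.coord_frame i x hx]
  open_target := (A.isOpen_U i).prod isOpen_univ
  baseSet := A.U i
  open_baseSet := A.isOpen_U i
  source_eq := rfl
  target_eq := rfl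
  proj_toFun _ _ := rfl

theorem pretriv_symm (i : A.ι) {x : X} (hx : x ∈ A.U i) (c : ℂ) :
    (A.pretriv i).symm x c = c • A.frame i x := by
  rw [Pretrivialization.symm_apply _ hx]; rfl

def coordChange (i j : A.ι) (x : X) : ℂ →L[ℂ] ℂ :=
  ContinuousLinearMap.toSpanSingleton ℂ (A.coord j x (A.frame i x))

theorem contMDiffOn_coordChange (i j : A.ι) :
    ContMDiffOn I 𝓘(ℂ, ℂ →L[ℂ] ℂ) ω (A.coordChange i j) (A.U i ∩ A.U j) := by
  have h : ContMDiff 𝓘(ℂ, ℂ) 𝓘(ℂ, ℂ →L[ℂ] ℂ) ω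
      (ContinuousLinearMap.toSpanSingletonCLE (𝕜 := ℂ) (E := ℂ)) :=
    (ContinuousLinearMap.contDiff
      (ContinuousLinearMap.toSpanSingletonCLE (𝕜 := ℂ) (E := ℂ)).toContinuousLinearMap).contMDiff
  exact h.comp_contMDiffOn (A.holo i j)

theorem coordChange_apply (i j : A.ι) (x : X) (hx : x ∈ A.U i ∩ A.U j) (c : ℂ) :
    A.coordChange i j x c = (A.pretriv j ⟨x, (A.pretriv i).symm x c⟩).2 := by
  rw [A.pretriv_symm i hx.1]
  change c • _ = A.coord j x (c • A.frame i x)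
  rw [map_smul]

abbrev fiberTopology (x : X) : TopologicalSpace (N x) :=
  TopologicalSpace.induced (A.coord (A.idx x) x) inferInstance

abbrev prebundle : letI := A.fiberTopology; VectorPrebundle ℂ ℂ N :=
  letI := A.fiberTopology
  { pretrivializationAtlas := Set.range A.pretriv
    pretrivialization_linear' := by
      rintro _ ⟨i, rfl⟩
      exact ⟨fun x _ => (A.coord i x).isLinear⟩
    pretrivializationAt := fun x => A.pretriv (A.idx x)
    mem_base_pretrivializationAt := A.mem_idx
    pretrivialization_mem_atlas := fun x => ⟨_, rfl⟩
    exists_coordChange := by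
      rintro _ ⟨i, rfl⟩ _ ⟨j, rfl⟩
      exact ⟨A.coordChange i j, (A.contMDiffOn_coordChange i j).continuousOn,
        fun x hx c => A.coordChange_apply i j x hx c⟩
    totalSpaceMk_isInducing := by
      intro x
      have h : Topology.IsInducing (A.coord (A.idx x) x) := ⟨rfl⟩
      exact Topology.isInducing_const_prod.mpr h }

theorem prebundle_isContMDiff :
    letI := A.fiberTopology; A.prebundle.IsContMDiff I ω :=
  letI := A.fiberTopology
  { exists_contMDiffCoordChange := by
      rintro _ ⟨i, rfl⟩ _ ⟨j, rfl⟩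
      exact ⟨A.coordChange i j, A.contMDiffOn_coordChange i j,
        fun x hx c => A.coordChange_apply i j x hx c⟩ }

/-- The holomorphic line bundle with fibres `N x` for which the given local frames are
holomorphic. -/
def toLineBundle : HolLineBundle I X :=
  letI := A.fiberTopology
  letI := A.prebundle.totalSpaceTopology
  letI := A.prebundle.toFiberBundle
  haveI := A.prebundle.toVectorBundle
  haveI := A.prebundle_isContMDiff
  haveI := A.prebundle.contMDiffVectorBundle (n := ω) I
  { Fiber := N }

end LocalFrames

/-- The trivial line bundle. -/
def trivial (I : ModelWithCorners ℂ E H) (X : Type) [TopologicalSpace X] [ChartedSpace H X] :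
    HolLineBundle I X where
  Fiber := Bundle.Trivial X ℂ

/-- The pullback `f^* L` along a holomorphic map `f`. -/
def pullback (L : HolLineBundle I X) (f : C^ω⟮I', Y; I, X⟯) : HolLineBundle I' Y where
  Fiber := f *ᵖ L.Fiber
  addCommGroup y := inferInstanceAs (AddCommGroup (L.Fiber (f y)))
  module y := inferInstanceAs (Module ℂ (L.Fiber (f y)))

/-- Isomorphism of holomorphic line bundles (covering the identity of the base). -/
structure Iso (L L' : HolLineBundle I X) where
  fiberEquiv : ∀ x, L.Fiber x ≃ₗ[ℂ] L'.Fiber x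
  holo : ContMDiff (I.prod 𝓘(ℂ, ℂ)) (I.prod 𝓘(ℂ, ℂ)) ω
    (fun v : TotalSpace ℂ L.Fiber =>
      (⟨v.proj, fiberEquiv v.proj v.snd⟩ : TotalSpace ℂ L'.Fiber))
  holo_symm : ContMDiff (I.prod 𝓘(ℂ, ℂ)) (I.prod 𝓘(ℂ, ℂ)) ω
    (fun v : TotalSpace ℂ L'.Fiber =>
      (⟨v.proj, (fiberEquiv v.proj).symm v.snd⟩ : TotalSpace ℂ L.Fiber))

/-- The local trivializations of `L`. -/
def Triv (L : HolLineBundle I X) : Type :=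
  {e : Trivialization ℂ (π ℂ L.Fiber) // MemTrivializationAtlas e}

instance (L : HolLineBundle I X) (e : L.Triv) : MemTrivializationAtlas e.1 := e.2

def trivAt (L : HolLineBundle I X) (x : X) : L.Triv :=
  ⟨trivializationAt ℂ L.Fiber x, inferInstance⟩

theorem holo_transition (L : HolLineBundle I X) (e e' : L.Triv) :
    ContMDiffOn I 𝓘(ℂ, ℂ) ω (fun x => e'.1.linearMapAt ℂ x (e.1.symmₗ ℂ x 1))
      (e.1.baseSet ∩ e'.1.baseSet) := by
  have h := (contMDiffOn_coordChangeL (n := ω) (IB := I) e.1 e'.1).clm_apply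
    (contMDiffOn_const (c := (1 : ℂ)))
  refine h.congr fun x hx => ?_
  rw [ContinuousLinearEquiv.coe_coe, Trivialization.coordChangeL_apply _ _ hx,
    Trivialization.coe_linearMapAt_of_mem _ hx.2, Trivialization.symmₗ_apply _ hx.1]

theorem linearMapAt_symm_one (L : HolLineBundle I X) (e : L.Triv) {x : X} (hx : x ∈ e.1.baseSet) :
    e.1.linearMapAt ℂ x (e.1.symmₗ ℂ x 1) = 1 :=
  e.1.linearMapAt_symmₗ hx 1

theorem smul_symm_one (L : HolLineBundle I X) (e : L.Triv) {x : X} (hx : x ∈ e.1.baseSet)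
    (v : L.Fiber x) : e.1.linearMapAt ℂ x v • e.1.symmₗ ℂ x 1 = v := by
  rw [← map_smul, smul_eq_mul, mul_one, e.1.symmₗ_linearMapAt hx]

def tensorFrames (L L' : HolLineBundle I X) :
    LocalFrames I (fun x => L.Fiber x ⊗[ℂ] L'.Fiber x) where
  ι := L.Triv × L'.Triv
  U i := i.1.1.baseSet ∩ i.2.1.baseSet
  isOpen_U i := i.1.1.open_baseSet.inter i.2.1.open_baseSet
  idx x := (L.trivAt x, L'.trivAt x)
  mem_idx x := ⟨mem_baseSet_trivializationAt _ _ _, mem_baseSet_trivializationAt _ _ _⟩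
  coord i x := LinearMap.mul' ℂ ℂ ∘ₗ
    TensorProduct.map (i.1.1.linearMapAt ℂ x) (i.2.1.linearMapAt ℂ x)
  frame i x := i.1.1.symmₗ ℂ x 1 ⊗ₜ[ℂ] i.2.1.symmₗ ℂ x 1
  coord_frame i x hx := by
    simp only [LinearMap.comp_apply, TensorProduct.map_tmul, LinearMap.mul'_apply]
    rw [L.linearMapAt_symm_one _ hx.1, L'.linearMapAt_symm_one _ hx.2, mul_one]
  coord_smul_frame i x hx v := by
    induction v with
    | zero => simp
    | add v w hv hw => rw [map_add, add_smul, hv, hw]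
    | tmul a b =>
      simp only [LinearMap.comp_apply, TensorProduct.map_tmul, LinearMap.mul'_apply]
      rw [← TensorProduct.smul_tmul_smul, L.smul_symm_one _ hx.1, L'.smul_symm_one _ hx.2]
  holo i j := by
    have h₁ := (L.holo_transition i.1 j.1).mono
      (t := i.1.1.baseSet ∩ i.2.1.baseSet ∩ (j.1.1.baseSet ∩ j.2.1.baseSet))
      (fun x hx => ⟨hx.1.1, hx.2.1⟩)
    have h₂ := (L'.holo_transition i.2 j.2).mono
      (t := i.1.1.baseSet ∩ i.2.1.baseSet ∩ (j.1.1.baseSet ∩ j.2.1.baseSet))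
      (fun x hx => ⟨hx.1.2, hx.2.2⟩)
    exact (h₁.mul h₂).congr fun x hx => by simp [TensorProduct.map_tmul]

/-- The tensor product `L ⊗ L'`, with fibres `L_x ⊗ L'_x`. -/
def tensor (L L' : HolLineBundle I X) : HolLineBundle I X := (tensorFrames L L').toLineBundle

def dualFrames (L : HolLineBundle I X) : LocalFrames I (fun x => Module.Dual ℂ (L.Fiber x)) where
  ι := L.Triv
  U e := e.1.baseSet
  isOpen_U e := e.1.open_baseSet
  idx x := L.trivAt x
  mem_idx x := mem_baseSet_trivializationAt _ _ _
  coord e x := Module.Dual.eval ℂ (L.Fiber x) (e.1.symmₗ ℂ x 1)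
  frame e x := e.1.linearMapAt ℂ x
  coord_frame e x hx := L.linearMapAt_symm_one e hx
  coord_smul_frame e x hx f := by
    ext v
    rw [LinearMap.smul_apply, Module.Dual.eval_apply, smul_eq_mul, mul_comm, ← smul_eq_mul,
      ← map_smul, L.smul_symm_one e hx]
  holo e e' := by
    rw [Set.inter_comm]
    exact L.holo_transition e' e

/-- The dual line bundle `L^*`, with fibres the dual spaces of the fibres of `L`. -/
def dual (L : HolLineBundle I X) : HolLineBundle I X := (dualFrames L).toLineBundle

/-! ### Multipliers -/

/-- Let `p : W → X` be a holomorphic map with `p (w + a k) = p w` (the covering by a vector space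
`W`, the `a k` being generators of the lattice). The functions `e k` form a system of multipliers
of `L` if `p^* L` has a holomorphic trivialization `φ` with `φ_{w + a k} = e k w • φ_w` as maps on
the common fibre `L_{p (w + a k)} = L_{p w}`; so, in terms of `φ`, sections of `L` are functions
`θ` on `W` with `θ (w + a k) = e k w * θ w`. -/
def HasMultipliers {W κ : Type} [TopologicalSpace W] [Add W] [ChartedSpace H' W]
    (L : HolLineBundle I X) (p : C^ω⟮I', W; I, X⟯) (a : κ → W) (e : κ → W → ℂ) : Prop :=
  (∀ k w, p (w + a k) = p w) ∧
  ∃ φ : Iso (L.pullback p) (trivial I' W), ∀ (k : κ) (w : W)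
    (v : L.Fiber (p w)) (v' : L.Fiber (p (w + a k))),
    (⟨p (w + a k), v'⟩ : TotalSpace ℂ L.Fiber) = ⟨p w, v⟩ →
      (show ℂ from φ.fiberEquiv (w + a k) v') = e k w * (show ℂ from φ.fiberEquiv w v)

end HolLineBundle

end

noncomputable section

/-! ### Complex tori -/

namespace Torus

variable {E : Type} [NormedAddCommGroup E] (Λ : AddSubgroup E) [DiscreteTopology Λ]

theorem isLocalHomeomorph_mk : IsLocalHomeomorph (QuotientAddGroup.mk : E → E ⧸ Λ) :=
  (Λ.isAddQuotientCoveringMap_of_comm DiscreteTopology.isDiscrete).isCoveringMap.isLocalHomeomorph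

/-- The charts of `E ⧸ Λ` are the local inverses of the projection `E → E ⧸ Λ`. -/
instance chartedSpace : ChartedSpace E (E ⧸ Λ) :=
  (isLocalHomeomorph_mk Λ).chartedSpace QuotientAddGroup.mk_surjective

theorem chart_symm {e : OpenPartialHomeomorph (E ⧸ Λ) E} (he : e ∈ atlas E (E ⧸ Λ)) (v : E) :
    e.symm v = (v : E ⧸ Λ) := by
  obtain ⟨q, rfl⟩ := he
  simp [chartAt_self_eq]

theorem mk_chart {e : OpenPartialHomeomorph (E ⧸ Λ) E} (he : e ∈ atlas E (E ⧸ Λ)) {x : E ⧸ Λ}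
    (hx : x ∈ e.source) : ((e x : E) : E ⧸ Λ) = x := by
  rw [← chart_symm Λ he, e.left_inv hx]

theorem eventually_translate {Y : Type} [TopologicalSpace Y] {y : Y} {s t : Y → E}
    (hs : ContinuousAt s y) (ht : ContinuousAt t y) (h : ∀ᶠ z in 𝓝 y, t z - s z ∈ Λ) :
    ∀ᶠ z in 𝓝 y, t z = s z + (t y - s y) := by
  obtain ⟨V, hV, hV'⟩ : ∃ V ∈ 𝓝 (0 : E), ∀ v ∈ V, v ∈ Λ → v = 0 := by
    have h0 : ({0} : Set Λ) ∈ 𝓝 (0 : Λ) := by rw [nhds_discrete]; simp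
    obtain ⟨V, hV, hVs⟩ := mem_nhds_subtype (Λ : Set E) 0 _ |>.1 h0
    refine ⟨V, hV, fun v hv hvΛ => ?_⟩
    have : (⟨v, hvΛ⟩ : Λ) ∈ ({0} : Set Λ) := hVs hv
    simpa using this
  have hc : ContinuousAt (fun z => t z - s z - (t y - s y)) y :=
    (ht.sub hs).sub continuousAt_const
  have hmem := h.self_of_nhds
  have hV0 : V ∈ 𝓝 (t y - s y - (t y - s y)) := by rwa [sub_self]
  filter_upwards [hc hV0, h] with z hz hz'
  have := hV' _ hz (Λ.sub_mem hz' hmem)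
  rw [← sub_eq_zero.1 this]; abel

theorem chart_mk_eventually {e : OpenPartialHomeomorph (E ⧸ Λ) E} (he : e ∈ atlas E (E ⧸ Λ))
    {v : E} (hv : (v : E ⧸ Λ) ∈ e.source) :
    (fun w : E => e (w : E ⧸ Λ)) =ᶠ[𝓝 v] fun w => w + (e (v : E ⧸ Λ) - v) := by
  have hmk : Continuous (QuotientAddGroup.mk : E → E ⧸ Λ) := (isLocalHomeomorph_mk Λ).continuous
  refine eventually_translate Λ (s := fun w : E => w) continuousAt_id
    (ContinuousAt.comp (f := (QuotientAddGroup.mk : E → E ⧸ Λ)) (g := e)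
      (e.continuousAt hv) hmk.continuousAt) ?_
  filter_upwards [hmk.continuousAt (e.open_source.mem_nhds hv)] with w hw
  have := mk_chart Λ he hw
  rw [eq_comm, QuotientAddGroup.eq] at this
  rwa [sub_eq_neg_add]

variable [NormedSpace ℂ E]

instance isManifold : IsManifold 𝓘(ℂ, E) ω (E ⧸ Λ) := by
  refine isManifold_of_contDiffOn _ _ _ fun e e' he he' v hv => ?_
  have hv' : v ∈ (e.symm ≫ₕ e').source := by simpa using hv
  rw [OpenPartialHomeomorph.trans_source] at hv'
  have h2 : (v : E ⧸ Λ) ∈ e'.source := by rw [← chart_symm Λ he]; exact hv'.2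
  refine ContDiffAt.contDiffWithinAt ?_
  have h : (𝓘(ℂ, E) ∘ (e.symm ≫ₕ e') ∘ 𝓘(ℂ, E).symm) = fun w : E => e' (w : E ⧸ Λ) := by
    funext w
    simp [chart_symm Λ he]
  rw [h]
  exact (contDiffAt_id.add contDiffAt_const).congr_of_eventuallyEq (chart_mk_eventually Λ he' h2)

theorem contMDiff_mk : ContMDiff 𝓘(ℂ, E) 𝓘(ℂ, E) ω (QuotientAddGroup.mk : E → E ⧸ Λ) := by
  intro v
  rw [contMDiffAt_iff_target]
  refine ⟨(isLocalHomeomorph_mk Λ).continuous.continuousAt, ?_⟩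
  have h := chart_mk_eventually Λ (chart_mem_atlas E (v : E ⧸ Λ)) (mem_chart_source E (v : E ⧸ Λ))
  refine ContMDiffAt.congr_of_eventuallyEq (f := fun w : E =>
    w + (chartAt E (v : E ⧸ Λ) (v : E ⧸ Λ) - v)) ?_ ?_
  · exact (contDiffAt_id.add contDiffAt_const).contMDiffAt
  · simpa [Function.comp_def] using h

theorem contMDiff_of_comp_mk {E' H' : Type} [NormedAddCommGroup E'] [NormedSpace ℂ E']
    [TopologicalSpace H'] {I' : ModelWithCorners ℂ E' H'} {Y : Type} [TopologicalSpace Y]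
    [ChartedSpace H' Y] {f : E ⧸ Λ → Y}
    (hf : ContMDiff 𝓘(ℂ, E) I' ω (fun v : E => f (v : E ⧸ Λ))) : ContMDiff 𝓘(ℂ, E) I' ω f := by
  intro x
  have hc : ContMDiffAt 𝓘(ℂ, E) 𝓘(ℂ, E) ω (chartAt E x) x :=
    contMDiffOn_chart.contMDiffAt ((chartAt E x).open_source.mem_nhds (mem_chart_source E x))
  refine (hf.contMDiffAt.comp x hc).congr_of_eventuallyEq ?_
  filter_upwards [(chartAt E x).open_source.mem_nhds (mem_chart_source E x)] with y hy
  exact congrArg f (mk_chart Λ (chart_mem_atlas E x) hy).symm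

/-- The projection `E → E ⧸ Λ`. -/
def proj : C^ω⟮𝓘(ℂ, E), E; 𝓘(ℂ, E), E ⧸ Λ⟯ := ⟨QuotientAddGroup.mk, contMDiff_mk Λ⟩

theorem contMDiff_add_right (m : E ⧸ Λ) : ContMDiff 𝓘(ℂ, E) 𝓘(ℂ, E) ω (fun x : E ⧸ Λ => x + m) := by
  obtain ⟨v, rfl⟩ := QuotientAddGroup.mk_surjective m
  exact contMDiff_of_comp_mk Λ ((contMDiff_mk Λ).comp
    (contDiff_id.add contDiff_const).contMDiff)

/-- The translation of `E ⧸ Λ` by `m`. -/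
def translation (m : E ⧸ Λ) : C^ω⟮𝓘(ℂ, E), E ⧸ Λ; 𝓘(ℂ, E), E ⧸ Λ⟯ :=
  ⟨fun x => x + m, contMDiff_add_right Λ m⟩

/-- The holomorphic map of tori induced by a continuous linear map. -/
def map {E' : Type} [NormedAddCommGroup E'] [NormedSpace ℂ E'] (Λ' : AddSubgroup E')
    [DiscreteTopology Λ'] (T : E →L[ℂ] E') (hT : ∀ v ∈ Λ, T v ∈ Λ') :
    C^ω⟮𝓘(ℂ, E), E ⧸ Λ; 𝓘(ℂ, E'), E' ⧸ Λ'⟯ :=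
  ⟨QuotientAddGroup.map Λ Λ' (T : E →+ E') hT,
    contMDiff_of_comp_mk Λ ((contMDiff_mk Λ').comp T.contDiff.contMDiff)⟩

/-! ### The line bundle with given multipliers -/

/-- A system of multipliers `{e_λ}` for the lattice `Λ`: nowhere vanishing holomorphic functions
satisfying the compatibility relations. -/
structure Multipliers where
  e : Λ → E → ℂ
  holo : ∀ l, ContDiff ℂ ω (e l)
  ne_zero : ∀ l v, e l v ≠ 0
  cocycle : ∀ l l' v, e (l + l') v = e l' (v + l) * e l v

namespace Multipliers

variable {Λ} (m : Multipliers Λ)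

theorem e_zero (v : E) : m.e 0 v = 1 := by
  have h := m.cocycle 0 0 v
  simp only [add_zero, ZeroMemClass.coe_zero] at h
  exact mul_right_cancel₀ (m.ne_zero 0 v) (by rw [one_mul]; exact h.symm)

/-- The fibre over `x` of the line bundle with multipliers `e_λ`: the functions `θ` on the coset
`x ⊆ E` with `θ (v + λ) = e_λ v * θ v`. Equivalently the fibre of `(E × ℂ) / Λ`, where
`λ` acts by `(v, c) ↦ (v + λ, e_λ v * c)`; evaluation at `v` is the isomorphism with `ℂ`. -/
def fiber (x : E ⧸ Λ) : Submodule ℂ ({v : E // (v : E ⧸ Λ) = x} → ℂ) where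
  carrier := {θ | ∀ (l : Λ) (v w : {v : E // (v : E ⧸ Λ) = x}), w.1 = v.1 + l →
    θ w = m.e l v * θ v}
  zero_mem' l v w _ := by simp
  add_mem' {a b} ha hb l v w h := by
    simp only [Pi.add_apply, ha l v w h, hb l v w h, mul_add]
  smul_mem' c a ha l v w h := by
    simp only [Pi.smul_apply, ha l v w h, smul_eq_mul]; ring

theorem sub_mem {x : E ⧸ Λ} (v w : {v : E // (v : E ⧸ Λ) = x}) : w.1 - v.1 ∈ Λ := by
  have := v.2.trans w.2.symm
  rw [QuotientAddGroup.eq] at this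
  rwa [sub_eq_neg_add]

/-- The element of the fibre with value `1` at `v`. -/
def unit {x : E ⧸ Λ} (v : {v : E // (v : E ⧸ Λ) = x}) : m.fiber x :=
  ⟨fun w => m.e ⟨w.1 - v.1, sub_mem v w⟩ v, fun l w w' h => by
    have : (⟨w'.1 - v.1, sub_mem v w'⟩ : Λ) = ⟨w.1 - v.1, sub_mem v w⟩ + l := by
      ext; simp [h]; abel
    change m.e ⟨w'.1 - v.1, _⟩ v = m.e l w * m.e ⟨w.1 - v.1, _⟩ v
    rw [this, m.cocycle]
    simp⟩

theorem unit_apply_self {x : E ⧸ Λ} (v : {v : E // (v : E ⧸ Λ) = x}) : (m.unit v).1 v = 1 := by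
  have : (⟨v.1 - v.1, sub_mem v v⟩ : Λ) = 0 := by ext; simp
  change m.e ⟨v.1 - v.1, sub_mem v v⟩ v = 1
  rw [this, m.e_zero]

theorem apply_smul_unit {x : E ⧸ Λ} (v : {v : E // (v : E ⧸ Λ) = x}) (θ : m.fiber x) :
    θ.1 v • m.unit v = θ := by
  ext w
  have := θ.2 ⟨w.1 - v.1, sub_mem v w⟩ v w (by simp)
  rw [this]
  change θ.1 v * m.e _ _ = _
  rw [mul_comm]

def point (x : E ⧸ Λ) : {v : E // (v : E ⧸ Λ) = x} :=
  ⟨x.out, QuotientAddGroup.out_eq' x⟩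

open scoped Classical in
/-- A point over `x`, given by the chart at `b` (a local section of `E → E ⧸ Λ`) near `b`. -/
def pt (b x : E ⧸ Λ) : {v : E // (v : E ⧸ Λ) = x} :=
  if h : x ∈ (chartAt E b).source then ⟨chartAt E b x, mk_chart Λ (chart_mem_atlas E b) h⟩
  else point x

theorem pt_coe {b x : E ⧸ Λ} (h : x ∈ (chartAt E b).source) : (pt b x).1 = chartAt E b x := by
  rw [pt, dif_pos h]

def frames : HolLineBundle.LocalFrames 𝓘(ℂ, E) (fun x : E ⧸ Λ => m.fiber x) where
  ι := E ⧸ Λ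
  U b := (chartAt E b).source
  isOpen_U b := (chartAt E b).open_source
  idx x := x
  mem_idx x := mem_chart_source E x
  coord b x := LinearMap.proj (pt b x) ∘ₗ (m.fiber x).subtype
  frame b x := m.unit (pt b x)
  coord_frame b x _ := m.unit_apply_self _
  coord_smul_frame b x _ θ := m.apply_smul_unit _ θ
  holo b c := by
    rintro x ⟨hb, hc⟩
    refine ContMDiffAt.contMDiffWithinAt ?_
    have hbn := (chartAt E b).open_source.mem_nhds hb
    have hcn := (chartAt E c).open_source.mem_nhds hc
    have hev := eventually_translate Λ (y := x) ((chartAt E b).continuousAt hb)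
      ((chartAt E c).continuousAt hc) (by
        filter_upwards [hbn, hcn] with z hzb hzc
        rw [← pt_coe hzb, ← pt_coe hzc]
        exact sub_mem _ _)
    have hl : chartAt E c x - chartAt E b x ∈ Λ := by
      rw [← pt_coe hb, ← pt_coe hc]
      exact sub_mem _ _
    have hchart : ContMDiffAt 𝓘(ℂ, E) 𝓘(ℂ, E) ω (chartAt E b) x :=
      contMDiffOn_chart.contMDiffAt hbn
    refine (((m.holo ⟨_, hl⟩).contMDiff.contMDiffAt).comp x hchart).congr_of_eventuallyEq ?_
    filter_upwards [hev, hbn, hcn] with z hz hzb hzc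
    change m.e ⟨(pt c z).1 - (pt b z).1, _⟩ (pt b z).1 = m.e ⟨_, hl⟩ (chartAt E b z)
    refine congr ?_ ?_
    · refine congrArg m.e (Subtype.ext ?_)
      simp [pt_coe hzb, pt_coe hzc, hz]
    · exact pt_coe hzb

/-- The holomorphic line bundle on `E ⧸ Λ` given by a system of multipliers. -/
def lineBundle : HolLineBundle 𝓘(ℂ, E) (E ⧸ Λ) := m.frames.toLineBundle

end Multipliers

end Torus

end

noncomputable section

/-! ### The elliptic curve `M`, the line bundle `L₀` and the dual torus -/

open Complex (I exp)
open UpperHalfPlane (im)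

theorem discreteTopology_of_norm {E : Type} [NormedAddCommGroup E] (Λ : AddSubgroup E) {ε : ℝ}
    (hε : 0 < ε) (h : ∀ v ∈ Λ, ‖v‖ < ε → v = 0) : DiscreteTopology Λ := by
  refine discreteTopology_of_isOpen_singleton_zero ?_
  have : ({0} : Set Λ) = Subtype.val ⁻¹' Metric.ball (0 : E) ε := by
    ext v
    simp only [Set.mem_singleton_iff, Set.mem_preimage, mem_ball_zero_iff]
    exact ⟨fun hv => by simpa [hv] using hε, fun hv => Subtype.ext (h v.1 v.2 hv)⟩
  rw [this]
  exact Metric.isOpen_ball.preimage continuous_subtype_val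

namespace EllipticCurve

variable (δ : ℕ+) (τ : UpperHalfPlane)

/-- The lattice `Λ = ℤ λ₁ + ℤ λ₂` in `V = ℂ`, where `λ₁ = δ` and `λ₂ = τ`. -/
def lattice : AddSubgroup ℂ := AddSubgroup.closure {(δ : ℂ), (τ : ℂ)}

theorem mem_lattice {v : ℂ} : v ∈ lattice δ τ ↔ ∃ a b : ℤ, a * (δ : ℂ) + b * (τ : ℂ) = v := by
  simp [lattice, AddSubgroup.mem_closure_pair]

theorem delta_mem : (δ : ℂ) ∈ lattice δ τ := (mem_lattice δ τ).2 ⟨1, 0, by simp⟩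

theorem tau_mem : (τ : ℂ) ∈ lattice δ τ := (mem_lattice δ τ).2 ⟨0, 1, by simp⟩

instance discreteTopology_lattice : DiscreteTopology (lattice δ τ) := by
  have hδ : (0 : ℝ) < (δ : ℕ) := by exact_mod_cast δ.pos
  refine discreteTopology_of_norm _ (lt_min τ.im_pos hδ) fun v hv hn => ?_
  obtain ⟨a, b, rfl⟩ := (mem_lattice δ τ).1 hv
  obtain ⟨h1, h2⟩ := lt_min_iff.1 hn
  have hb : b = 0 := by
    have h := (Complex.abs_im_le_norm _).trans_lt h1
    have e : (a * ((δ : ℕ) : ℂ) + b * (τ : ℂ)).im = b * τ.im := by simp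
    rw [e, abs_mul, abs_of_pos τ.im_pos] at h
    have h' : |(b : ℝ)| < 1 := by
      by_contra hc
      nlinarith [τ.im_pos, not_lt.1 hc]
    exact Int.abs_lt_one_iff.1 (by exact_mod_cast h')
  subst hb
  have ha : a = 0 := by
    have h : |(a : ℝ)| * (δ : ℕ) < (δ : ℕ) := by simpa using h2
    have h' : |(a : ℝ)| < 1 := by
      by_contra hc
      nlinarith [not_lt.1 hc]
    exact Int.abs_lt_one_iff.1 (by exact_mod_cast h')
  simp [ha]

/-- The complex torus `M = V / Λ`. -/
abbrev M : Type := ℂ ⧸ lattice δ τ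

/-- The multipliers `e_λ(z) = exp (-2πi n z - πi n² τ)` for `λ = m λ₁ + n λ₂`; here
`n = Im λ / Im τ`. -/
def multipliersL0 : Torus.Multipliers (lattice δ τ) where
  e l z := exp (-2 * Real.pi * I * ((l.1.im / τ.im : ℝ) : ℂ) * z
    - Real.pi * I * ((l.1.im / τ.im : ℝ) : ℂ) ^ 2 * τ)
  holo l := by
    apply ContDiff.cexp
    fun_prop
  ne_zero l v := Complex.exp_ne_zero _
  cocycle := by
    rintro ⟨l, hl⟩ ⟨l', hl'⟩ z
    obtain ⟨a, b, rfl⟩ := (mem_lattice δ τ).1 hl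
    obtain ⟨a', b', rfl⟩ := (mem_lattice δ τ).1 hl'
    have hτ := τ.im_pos.ne'
    have e1 : (a * ((δ : ℕ) : ℂ) + b * (τ : ℂ)).im / τ.im = (b : ℝ) := by simp [hτ]
    have e2 : (a' * ((δ : ℕ) : ℂ) + b' * (τ : ℂ)).im / τ.im = (b' : ℝ) := by simp [hτ]
    have e3 : ((a * ((δ : ℕ) : ℂ) + b * (τ : ℂ)) + (a' * ((δ : ℕ) : ℂ) + b' * (τ : ℂ))).im / τ.im
        = ((b + b' : ℤ) : ℝ) := by
      rw [Complex.add_im, add_div, e1, e2]; push_cast; rfl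
    simp only [AddMemClass.mk_add_mk, e1, e2, e3]
    rw [← Complex.exp_add, Complex.exp_eq_exp_iff_exists_int]
    exact ⟨b' * a * (δ : ℕ), by push_cast; ring⟩

theorem multipliersL0_delta (z : ℂ) : (multipliersL0 δ τ).e ⟨δ, delta_mem δ τ⟩ z = 1 := by
  simp [multipliersL0]

theorem multipliersL0_tau (z : ℂ) : (multipliersL0 δ τ).e ⟨τ, tau_mem δ τ⟩ z =
    exp (-2 * Real.pi * I * z - Real.pi * I * τ) := by
  simp [multipliersL0, τ.im_pos.ne']

/-- The line bundle `L₀` on `M`, with `e_{λ₁} = 1` and `e_{λ₂}(z) = exp (-2πiz - πiτ)`. -/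
def L0 : HolLineBundle 𝓘(ℂ, ℂ) (M δ τ) := (multipliersL0 δ τ).lineBundle

/-- The space `V̄^*` of conjugate linear functionals on `V = ℂ`, which is `H^{0,1}(M)`
(`α` corresponds to the form `σ dz̄`, where `α z = σ z̄`). -/
abbrev ConjDual : Type := ℂ →L⋆[ℂ] ℂ

/-- The dual lattice `Λ̄^*`, the image of `H¹(M, ℤ)` in `V̄^*`: the conjugate linear functionals
whose real part is half-integral on `Λ`. -/
def dualLattice : AddSubgroup ConjDual where
  carrier := {α | ∀ l ∈ lattice δ τ, ∃ n : ℤ, (α l).re = n / 2}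
  zero_mem' l _ := ⟨0, by simp⟩
  add_mem' {α β} hα hβ l hl := by
    obtain ⟨n, hn⟩ := hα l hl
    obtain ⟨k, hk⟩ := hβ l hl
    exact ⟨n + k, by simp [hn, hk]; ring⟩
  neg_mem' {α} hα l hl := by
    obtain ⟨n, hn⟩ := hα l hl
    exact ⟨-n, by simp [hn]; ring⟩

theorem conjDual_apply (α : ConjDual) (z : ℂ) : α z = α 1 * conj z := by
  have := α.map_smulₛₗ z 1
  simpa [mul_comm] using this

instance discreteTopology_dualLattice : DiscreteTopology (dualLattice δ τ) := by
  have hδ : (0 : ℝ) < (δ : ℕ) := by exact_mod_cast δ.pos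
  have hpos : 0 < ‖(τ : ℂ)‖ + (δ : ℕ) := by positivity
  refine discreteTopology_of_norm _ (ε := 1 / (2 * (‖(τ : ℂ)‖ + (δ : ℕ)))) (by positivity)
    fun α hα hn => ?_
  have key : ∀ l ∈ lattice δ τ, ‖l‖ ≤ ‖(τ : ℂ)‖ + (δ : ℕ) → (α l).re = 0 := by
    intro l hl hle
    obtain ⟨n, h⟩ := hα l hl
    have h1 : |(α l).re| < 1 / 2 := by
      calc |(α l).re| ≤ ‖α l‖ := Complex.abs_re_le_norm _
        _ ≤ ‖α‖ * ‖l‖ := α.le_opNorm l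
        _ ≤ ‖α‖ * (‖(τ : ℂ)‖ + (δ : ℕ)) := by gcongr
        _ < 1 / (2 * (‖(τ : ℂ)‖ + (δ : ℕ))) * (‖(τ : ℂ)‖ + (δ : ℕ)) := by gcongr
        _ = 1 / 2 := by field_simp
    rw [h, abs_div, abs_two] at h1
    have h2 : |(n : ℝ)| < 1 := by linarith
    have : n = 0 := Int.abs_lt_one_iff.1 (by exact_mod_cast h2)
    rw [h, this]; simp
  have h1 := key _ (delta_mem δ τ) (by simp)
  have h2 := key _ (tau_mem δ τ) (by simp)
  rw [conjDual_apply] at h1 h2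
  have hre : (α 1).re = 0 := by simpa [hδ.ne'] using h1
  have him : (α 1).im = 0 := by simpa [hre, τ.im_pos.ne'] using h2
  have h0 : α 1 = 0 := Complex.ext hre him
  refine ContinuousLinearMap.ext fun z => ?_
  rw [conjDual_apply, h0, zero_mul]
  rfl

/-- The dual torus `M̂ = Pic⁰(M) = V̄^* / Λ̄^*`. -/
abbrev DualTorus : Type := ConjDual ⧸ dualLattice δ τ

/-- The constant multipliers `e_λ = exp (2πi α(λ))`. -/
def flatMultipliers (α : ConjDual) : Torus.Multipliers (lattice δ τ) where
  e l _ := exp (2 * Real.pi * I * α l)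
  holo _ := contDiff_const
  ne_zero _ _ := Complex.exp_ne_zero _
  cocycle l l' _ := by
    rw [← Complex.exp_add]
    congr 1
    simp [map_add]
    ring

/-- The degree zero line bundle `P_α` on `M` corresponding to `[α] ∈ M̂ = Pic⁰(M)`, given by the
multipliers `exp (2πi α(λ))`. -/
def degreeZeroBundle (α : ConjDual) : HolLineBundle 𝓘(ℂ, ℂ) (M δ τ) :=
  (flatMultipliers δ τ α).lineBundle

/-- The functional `e₁^* = (-i / (2 Im τ)) dz̄`. -/
def e1star : ConjDual := (-I / (2 * τ.im)) • ((starL ℂ : ℂ ≃L⋆[ℂ] ℂ) : ℂ →L⋆[ℂ] ℂ)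

theorem e1star_apply (z : ℂ) : e1star τ z = -I / (2 * τ.im) * conj z := rfl

theorem smul_e1star_mem (μ : ℂ) (hμ : μ ∈ lattice δ τ) :
    ContinuousLinearMap.toSpanSingleton ℂ (e1star τ) μ ∈ dualLattice δ τ := by
  obtain ⟨a, b, rfl⟩ := (mem_lattice δ τ).1 hμ
  intro l hl
  obtain ⟨a', b', rfl⟩ := (mem_lattice δ τ).1 hl
  refine ⟨(δ : ℕ) * (b * a' - a * b'), ?_⟩
  have hτ := τ.im_pos.ne'
  have h : ((a * ((δ : ℕ) : ℂ) + b * (τ : ℂ)) * (-I / (2 * τ.im) *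
      conj (a' * ((δ : ℕ) : ℂ) + b' * (τ : ℂ)))) =
      ((a * ((δ : ℕ) : ℂ) + b * (τ : ℂ)) * (-I *
      conj (a' * ((δ : ℕ) : ℂ) + b' * (τ : ℂ)))) * (((2 * τ.im)⁻¹ : ℝ) : ℂ) := by
    push_cast
    ring
  change (((a * ((δ : ℕ) : ℂ) + b * (τ : ℂ)) * (-I / (2 * τ.im) *
      conj (a' * ((δ : ℕ) : ℂ) + b' * (τ : ℂ))))).re = _
  rw [h, Complex.re_mul_ofReal]
  simp
  field_simp
  ring

/-- The map `φ_{L₀} : M → M̂`, induced by the complex linear map `V → V̄^*`, `μ ↦ μ e₁^*`. It is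
part of the theorem that `φ_{L₀} [μ]` is the class of `T_μ^* L₀ ⊗ L₀^*`. -/
def phi : C^ω⟮𝓘(ℂ, ℂ), M δ τ; 𝓘(ℂ, ConjDual), DualTorus δ τ⟯ :=
  Torus.map (lattice δ τ) (dualLattice δ τ)
    (ContinuousLinearMap.toSpanSingleton ℂ (e1star τ)) (smul_e1star_mem δ τ)

/-! ### The Poincaré bundle and the bundle `K̃` -/

/-- Holomorphic line bundles on `M × M̂`. -/
abbrev BundleOnMDual : Type 1 :=
  HolLineBundle (𝓘(ℂ, ℂ).prod 𝓘(ℂ, ConjDual)) (M δ τ × DualTorus δ τ)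

/-- Holomorphic line bundles on `M × M`. -/
abbrev BundleOnMM : Type 1 :=
  HolLineBundle (𝓘(ℂ, ℂ).prod 𝓘(ℂ, ℂ)) (M δ τ × M δ τ)

/-- The inclusion of `M` as `M × {ξ}`. -/
def inclLeft (ξ : DualTorus δ τ) :
    C^ω⟮𝓘(ℂ, ℂ), M δ τ; 𝓘(ℂ, ℂ).prod 𝓘(ℂ, ConjDual), M δ τ × DualTorus δ τ⟯ :=
  ⟨fun x => (x, ξ), contMDiff_id.prodMk contMDiff_const⟩

/-- The inclusion of `M̂` as `{x} × M̂`. -/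
def inclRight (x : M δ τ) :
    C^ω⟮𝓘(ℂ, ConjDual), DualTorus δ τ; 𝓘(ℂ, ℂ).prod 𝓘(ℂ, ConjDual), M δ τ × DualTorus δ τ⟯ :=
  ⟨fun ξ => (x, ξ), contMDiff_const.prodMk contMDiff_id⟩

/-- `P` is a Poincaré line bundle: `P` restricts to `P_α` on `M × {[α]}`, and to a trivial
bundle on `{0} × M̂`. -/
def IsPoincare (P : BundleOnMDual δ τ) : Prop :=
  (∀ α : ConjDual, Nonempty ((P.pullback (inclLeft δ τ (α : DualTorus δ τ))).Iso
    (degreeZeroBundle δ τ α))) ∧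
  Nonempty ((P.pullback (inclRight δ τ 0)).Iso
    (HolLineBundle.trivial 𝓘(ℂ, ConjDual) (DualTorus δ τ)))

/-- The map `Id × φ_{L₀} : M × M → M × M̂`. -/
def idProdPhi : C^ω⟮𝓘(ℂ, ℂ).prod 𝓘(ℂ, ℂ), M δ τ × M δ τ;
    𝓘(ℂ, ℂ).prod 𝓘(ℂ, ConjDual), M δ τ × DualTorus δ τ⟯ :=
  ⟨Prod.map id (phi δ τ), contMDiff_id.prodMap (phi δ τ).contMDiff⟩

/-- The line bundle `K̃ = π₁^* L₀ ⊗ (Id × φ_{L₀})^* P ⊗ π₂^* L₀` on `M × M`. -/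
def KTilde (P : BundleOnMDual δ τ) : BundleOnMM δ τ :=
  (((L0 δ τ).pullback ContMDiffMap.fst).tensor (P.pullback (idProdPhi δ τ))).tensor
    ((L0 δ τ).pullback ContMDiffMap.snd)

/-- The covering `V × V → M × M`. -/
def projMM : C^ω⟮𝓘(ℂ, ℂ).prod 𝓘(ℂ, ℂ), ℂ × ℂ; 𝓘(ℂ, ℂ).prod 𝓘(ℂ, ℂ), M δ τ × M δ τ⟯ :=
  ⟨Prod.map (Torus.proj (lattice δ τ)) (Torus.proj (lattice δ τ)),
    (Torus.proj _).contMDiff.prodMap (Torus.proj _).contMDiff⟩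

/-- The generators `λ₁₀, λ₂₀, λ₀₁, λ₀₂` of the lattice `Λ × Λ` in `V × V`. -/
def gens : Fin 4 → ℂ × ℂ := ![((δ : ℂ), 0), ((τ : ℂ), 0), (0, (δ : ℂ)), (0, (τ : ℂ))]

end EllipticCurve

end

/-! Write `n` for the coordinate `tauCoord τ l` of a lattice vector `l`, so that `l - conj l = 2i n
Im τ`. A line bundle on a torus is determined by the factors by which a holomorphic frame of its
pullback to the vector space changes under lattice translations, so every assertion is reduced to
producing frames with prescribed factors.

Classifying map. The constant multipliers of `P_α`, for `α = μ e₁^* + β` with `β` in the dual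
lattice, become the factors `exp(2πi n μ)` after rescaling the frame by a suitable exponential: the
part `μ e₁^*` contributes `l - conj l`, the part `β` contributes `2 Re β(l)`, an integer. The tensor
product of the translate of `L₀` with the dual of `L₀` has the same factors. Existence of a Poincaré
bundle follows from an explicit cocycle.

An arbitrary Poincaré bundle. Its definition only gives, for each `μ` separately, an isomorphism on
the slice `M × {[μ e₁^*]}`, and a trivialization on `{0} × M̂`. Take on each slice the frame with
factors `exp(2πi n μ)` and scale it to agree with the trivialization at `z = 0`. The resulting
section on `ℂ × ℂ` is holomorphic in `z` and along `z = 0`, but its dependence on `μ` elsewhere is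
not controlled in advance. The main point (`IsSliceFamily.analyticAt`) is that it is nevertheless
jointly holomorphic. For this, difference quotients in `μ` are studied at a fixed `μ₀`. Normalised
by their maximum over finitely many discs covering `M`, they have limits along ultrafilters by
Montel's theorem. Two limits differ by a holomorphic section over the compact slice that vanishes at
`0`; divided by the given nowhere vanishing section it is a constant, hence zero. This rigidity
rules out that the maximum is unbounded and shows that the limit is unique. So the section is
continuous and differentiable in `μ`, and Osgood's lemma applies.

Factors in the direction of `μ`. Translation of `μ` by `l` multiplies the frame by a function `c(z)`
with `c(0) = 1`. Comparing the two orders of translation determines the quasi-periods of `c`; by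
Liouville's theorem and the integrality of `exists_int_of_mem_lattice`, `c(z) = exp(2πi n z)`.
Tensoring with the frames of the two copies of `L₀` gives the multipliers of `K̃`. -/

noncomputable section

/-! ### Complex analysis -/

open Filter Metric Set in
/-- Montel's theorem along an ultrafilter. -/
theorem exists_tendstoLocallyUniformlyOn_of_bounded {ι : Type*} (U : Ultrafilter ι)
    {w : ι → ℂ → ℂ} {c : ℂ} {r C : ℝ}
    (hd : ∀ᶠ i in (U : Filter ι), DifferentiableOn ℂ (w i) (ball c r))
    (hb : ∀ᶠ i in (U : Filter ι), ∀ z ∈ ball c r, ‖w i z‖ ≤ C) :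
    ∃ W : ℂ → ℂ, DifferentiableOn ℂ W (ball c r) ∧
      TendstoLocallyUniformlyOn w W U (ball c r) := by
  -- A bounded family of complex numbers converges along every ultrafilter, since closed balls are
  -- compact; no subsequence has to be extracted.
  have hlim : ∀ z ∈ ball c r, ∃ a, Tendsto (fun i => w i z) U (𝓝 a) := by
    intro z hz
    have hmem : closedBall (0 : ℂ) C ∈ (U.map fun i => w i z) := by
      change ∀ᶠ i in (U : Filter ι), w i z ∈ closedBall (0 : ℂ) C
      filter_upwards [hb] with i hi
      simpa using hi z hz
    obtain ⟨a, -, ha⟩ := (isCompact_closedBall (0 : ℂ) C).ultrafilter_le_nhds (U.map fun i => w i z)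
      (Filter.le_principal_iff.2 hmem)
    exact ⟨a, ha⟩
  choose! W hW using hlim
  -- Circles of radius `ρ` about points of `ball z ρ` stay inside `ball z (2 * ρ)`, so Cauchy's
  -- estimate bounds the derivatives by `C / ρ`. The equi-Lipschitz bound turns pointwise into
  -- locally uniform convergence.
  have hlip : ∀ z ρ, 0 < ρ → ball z (2 * ρ) ⊆ ball c r → ∀ᶠ i in (U : Filter ι),
      ∀ x ∈ ball z ρ, ∀ y ∈ ball z ρ, ‖w i x - w i y‖ ≤ C / ρ * ‖x - y‖ := by
    intro z ρ hρ hsub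
    filter_upwards [hd, hb] with i hi hi' x hx y hy
    refine (convex_ball z ρ).norm_image_sub_le_of_norm_deriv_le (f := w i) (fun p hp => ?_)
      (fun p hp => ?_) hy hx
    · exact hi.differentiableAt (isOpen_ball.mem_nhds
        (hsub (ball_subset_ball (by linarith) hp)))
    · refine Complex.norm_deriv_le_of_forall_mem_sphere_norm_le hρ ?_ fun q hq => ?_
      · refine (hi.mono ?_).diffContOnCl_ball (U := ball z (2 * ρ)) fun q hq => ?_
        · exact hsub
        · rw [mem_closedBall] at hq
          rw [mem_ball] at hp ⊢
          linarith [dist_triangle q p z]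
      · refine hi' q (hsub ?_)
        rw [mem_sphere] at hq
        rw [mem_ball] at hp ⊢
        linarith [dist_triangle q p z]
  have hu : TendstoLocallyUniformlyOn w W U (ball c r) := by
    rw [tendstoLocallyUniformlyOn_iff]
    intro ε hε z hz
    have hz' := mem_ball.1 hz
    set ρ := (r - dist z c) / 2 with hρdef
    have hρ : 0 < ρ := by rw [hρdef]; linarith
    have hsub : ball z (2 * ρ) ⊆ ball c r := by
      intro y hy
      rw [mem_ball] at hy ⊢
      have := dist_triangle y z c
      rw [hρdef] at hy
      linarith
    have hC : 0 ≤ C := by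
      obtain ⟨i, hi⟩ := hb.exists
      exact (norm_nonneg _).trans (hi z hz)
    have hL := hlip z ρ hρ hsub
    obtain ⟨η, hη, hη'⟩ : ∃ η > 0, C / ρ * η < ε / 3 := by
      refine ⟨ε / 3 / (C / ρ + 1), by positivity, ?_⟩
      have : 0 ≤ C / ρ := by positivity
      rw [mul_div_assoc', div_lt_iff₀ (by positivity)]
      nlinarith
    refine ⟨ball z (min ρ η), mem_nhdsWithin_of_mem_nhds (ball_mem_nhds z (by positivity)), ?_⟩
    filter_upwards [hL, (tendsto_iff_norm_sub_tendsto_zero.1 (hW z hz)).eventually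
      (gt_mem_nhds (show (0:ℝ) < ε / 3 by positivity))] with i hi hi' y hy
    have hy1 : y ∈ ball z ρ := ball_subset_ball (min_le_left _ _) hy
    have hy2 : ‖y - z‖ < η := by
      rw [← dist_eq_norm]; exact ball_subset_ball (min_le_right _ _) hy
    have hzz : z ∈ ball z ρ := mem_ball_self hρ
    have hsm : C / ρ * ‖y - z‖ < ε / 3 :=
      (mul_le_mul_of_nonneg_left hy2.le (by positivity)).trans_lt hη'
    have h1 : ‖w i y - w i z‖ < ε / 3 := (hi y hy1 z hzz).trans_lt hsm
    have h2 : ‖W y - W z‖ ≤ C / ρ * ‖y - z‖ := by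
      refine le_of_tendsto ((hW y ?_).sub (hW z hz)).norm ?_
      · exact hsub (ball_subset_ball (by linarith) hy1)
      · filter_upwards [hL] with j hj
        exact hj y hy1 z hzz
    rw [dist_eq_norm]
    calc ‖W y - w i y‖ = ‖(W y - W z) - (w i z - W z) - (w i y - w i z)‖ := by ring_nf
      _ ≤ ‖W y - W z‖ + ‖w i z - W z‖ + ‖w i y - w i z‖ :=
        (norm_sub_le _ _).trans (add_le_add_left (norm_sub_le _ _) _)
      _ < ε := by linarith
  exact ⟨W, hu.differentiableOn hd isOpen_ball, hu⟩

/-! ### Osgood's lemma, by Cauchy's formula in a Banach algebra of continuous functions -/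

section Osgood

open Metric Set

variable {z₀ w₀ : ℂ} {R : ℝ}

/-- Integration over a circle, as a functional on the continuous functions on the circle. -/
def circleIntegralCLM (z₀ : ℂ) {R : ℝ} (hR : 0 ≤ R) : C(sphere z₀ R, ℂ) →L[ℂ] ℂ :=
  LinearMap.mkContinuous
    { toFun g := ∫ θ in (0 : ℝ)..2 * Real.pi, deriv (circleMap z₀ R) θ •
        g ⟨circleMap z₀ R θ, circleMap_mem_sphere z₀ hR θ⟩
      map_add' g h := by
        rw [← intervalIntegral.integral_add]
        · simp [mul_add]
        · exact Continuous.intervalIntegrable (by simp only [deriv_circleMap]; fun_prop) _ _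
        · exact Continuous.intervalIntegrable (by simp only [deriv_circleMap]; fun_prop) _ _
      map_smul' a g := by
        rw [RingHom.id_apply, ← intervalIntegral.integral_smul]
        simp [mul_left_comm] }
    (R * |2 * Real.pi - 0|) (fun g => by
      have := intervalIntegral.norm_integral_le_of_norm_le_const (a := 0) (b := 2 * Real.pi)
        (C := R * ‖g‖) (f := fun θ => deriv (circleMap z₀ R) θ •
        g ⟨circleMap z₀ R θ, circleMap_mem_sphere z₀ hR θ⟩) (fun θ _ => by
          rw [norm_smul]
          gcongr
          · simp [abs_of_nonneg hR]
          · exact g.norm_coe_le_norm _)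
      refine this.trans (le_of_eq ?_)
      ring)

theorem circleIntegralCLM_apply (hR : 0 ≤ R) {g : C(sphere z₀ R, ℂ)} {f : ℂ → ℂ}
    (h : ∀ ζ : sphere z₀ R, g ζ = f ζ) :
    circleIntegralCLM z₀ hR g = ∮ ζ in C(z₀, R), f ζ := by
  change (∫ θ in (0 : ℝ)..2 * Real.pi, deriv (circleMap z₀ R) θ •
        g ⟨circleMap z₀ R θ, circleMap_mem_sphere z₀ hR θ⟩) = _
  simp only [h, circleIntegral]

/-- A family of functions on a compact space which is continuous, and holomorphic in the parameter,
is holomorphic in the parameter as a family with values in the Banach space of continuous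
functions. -/
theorem analyticAt_continuousMap {K : Type*} [TopologicalSpace K] [CompactSpace K] (hR : 0 < R)
    {f : K → ℂ → ℂ} (hc : ContinuousOn (fun p : K × ℂ => f p.1 p.2) (univ ×ˢ closedBall w₀ R))
    (hd : ∀ k, DifferentiableOn ℂ (f k) (closedBall w₀ R)) :
    ∃ F : ℂ → C(K, ℂ), AnalyticAt ℂ F w₀ ∧ ∀ w ∈ ball w₀ R, ∀ k, F w k = f k w := by
  let g : C(closedBall w₀ R × K, ℂ) := ⟨fun p => f p.2 p.1, by
    refine hc.comp_continuous (f := fun p : closedBall w₀ R × K => (p.2, (p.1 : ℂ)))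
      (by fun_prop) (fun p => ⟨mem_univ _, p.1.2⟩)⟩
  classical
  let H : ℂ → C(K, ℂ) := fun w => if h : w ∈ closedBall w₀ R then g.curry ⟨w, h⟩ else 0
  have hH : ContinuousOn H (closedBall w₀ R) := by
    rw [continuousOn_iff_continuous_domRestrict]
    refine g.curry.continuous.congr fun w => ?_
    change _ = H w
    simp only [H, dif_pos w.2]
  have hint : CircleIntegrable H w₀ R := (hH.mono sphere_subset_closedBall).circleIntegrable hR.le
  let Rn : NNReal := ⟨R, hR.le⟩
  -- `F` is the Cauchy integral of the curried function `H`, hence analytic. Evaluation at `k`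
  -- commutes with the integral, so the scalar Cauchy formula identifies `F w k` with `f k w`.
  have hp := hasFPowerSeriesOn_cauchy_integral (R := Rn) hint hR
  refine ⟨_, hp.analyticAt, fun w hw k => ?_⟩
  have hk : ∀ ξ ∈ closedBall w₀ R, H ξ k = f k ξ := by
    intro ξ hξ
    simp only [H, dif_pos hξ]
    rfl
  have hcauchy := Complex.two_pi_I_inv_smul_circleIntegral_sub_inv_smul_of_differentiable_on_off_countable
    (s := ∅) countable_empty hw ((hd k).continuousOn)
    (fun x hx => (hd k).differentiableAt (closedBall_mem_nhds_of_mem hx.1))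
  rw [← hcauchy]
  have hs : ContinuousOn (fun ξ => (ξ - w)⁻¹ • H ξ) (sphere w₀ R) := by
    refine ContinuousOn.smul (ContinuousOn.inv₀ (continuousOn_id.sub continuousOn_const)
      fun ξ hξ h0 => ?_) (hH.mono sphere_subset_closedBall)
    have h0 : ξ = w := sub_eq_zero.1 h0
    subst h0
    rw [mem_sphere] at hξ
    rw [mem_ball] at hw
    linarith
  have hi := (hs.circleIntegrable hR.le).out
  rw [ContinuousMap.smul_apply]
  congr 1
  change ContinuousMap.evalCLM ℂ k (∮ ξ in C(w₀, R), (ξ - w)⁻¹ • H ξ) = _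
  rw [circleIntegral, ← ContinuousLinearMap.intervalIntegral_comp_comm _ hi, circleIntegral]
  refine intervalIntegral.integral_congr fun θ _ => ?_
  simp only [map_smul]
  congr 2
  exact hk _ (sphere_subset_closedBall (circleMap_mem_sphere w₀ hR.le θ))

/-- Osgood's lemma: a continuous function of two complex variables which is holomorphic in each
variable is holomorphic. -/
theorem analyticAt_of_separately {Ω : Set (ℂ × ℂ)} (hΩ : IsOpen Ω) {f : ℂ × ℂ → ℂ}
    (hc : ContinuousOn f Ω)
    (h₁ : ∀ p ∈ Ω, DifferentiableAt ℂ (fun z => f (z, p.2)) p.1)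
    (h₂ : ∀ p ∈ Ω, DifferentiableAt ℂ (fun w => f (p.1, w)) p.2) {p : ℂ × ℂ} (hp : p ∈ Ω) :
    AnalyticAt ℂ f p := by
  obtain ⟨z₀, w₀⟩ := p
  obtain ⟨R, hR, hsub⟩ := nhds_basis_closedBall.mem_iff.1 (hΩ.mem_nhds hp)
  rw [← closedBall_prod_same] at hsub
  have hcirc : ∀ ζ : sphere z₀ R, (ζ : ℂ) ∈ closedBall z₀ R := fun ζ => sphere_subset_closedBall ζ.2
  obtain ⟨F, hF, hFf⟩ := analyticAt_continuousMap (K := sphere z₀ R) (w₀ := w₀) hR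
    (f := fun ζ w => f (ζ, w))
    (hc.comp (f := fun p : sphere z₀ R × ℂ => ((p.1 : ℂ), p.2)) (by fun_prop)
      fun p hp => hsub ⟨hcirc _, hp.2⟩)
    (fun ζ w hw => (h₂ (ζ, w) (hsub ⟨hcirc _, hw⟩)).differentiableWithinAt)
  let J : C(sphere z₀ R, ℂ) := ⟨fun ζ => ζ, continuous_subtype_val⟩
  have hunit : ∀ z ∈ ball z₀ R, ∃ u : C(sphere z₀ R, ℂ)ˣ, (u : C(sphere z₀ R, ℂ)) =
      J - algebraMap ℂ _ z ∧ ∀ ζ, (↑u⁻¹ : C(sphere z₀ R, ℂ)) ζ = (ζ - z)⁻¹ := by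
    intro z hz
    have hne : ∀ ζ : sphere z₀ R, (ζ : ℂ) - z ≠ 0 := by
      intro ζ h0
      rw [sub_eq_zero] at h0
      have := mem_sphere.1 ζ.2
      rw [h0] at this
      linarith [mem_ball.1 hz]
    exact ⟨⟨J - algebraMap ℂ _ z, ⟨fun ζ => (ζ - z)⁻¹,
      Continuous.inv₀ (by fun_prop) hne⟩, by
        ext ζ; simpa [J] using mul_inv_cancel₀ (hne ζ), by
        ext ζ; simpa [J] using inv_mul_cancel₀ (hne ζ)⟩, rfl, fun ζ => rfl⟩
  -- The Cauchy kernel `ζ ↦ (ζ - z)⁻¹`, analytic in `z` because inversion is analytic at units of a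
  -- Banach algebra. Then `f (z, w)` is `(2πi)⁻¹` times the circle integral of `k z * F w`, a
  -- bounded linear functional of an analytic function of the pair.
  let k : ℂ → C(sphere z₀ R, ℂ) := fun z => Ring.inverse (J - algebraMap ℂ _ z)
  have hk : AnalyticAt ℂ k z₀ := by
    obtain ⟨u, hu, -⟩ := hunit z₀ (mem_ball_self hR)
    have h1 : AnalyticAt ℂ (fun z : ℂ => J - algebraMap ℂ C(sphere z₀ R, ℂ) z) z₀ :=
      analyticAt_const.sub ((Algebra.linearMap ℂ C(sphere z₀ R, ℂ)).toContinuousLinearMap.analyticAt z₀)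
    refine AnalyticAt.comp (g := Ring.inverse) ?_ h1
    rw [← hu]
    exact analyticAt_inverse u
  have hprod : AnalyticAt ℂ (fun p : ℂ × ℂ => k p.1 * F p.2) (z₀, w₀) :=
    (hk.comp_of_eq analyticAt_fst rfl).mul (hF.comp_of_eq analyticAt_snd rfl)
  refine AnalyticAt.congr (f := (2 * Real.pi * Complex.I : ℂ)⁻¹ •
      (circleIntegralCLM z₀ hR.le ∘ fun p : ℂ × ℂ => k p.1 * F p.2))
    (AnalyticAt.const_smul (((circleIntegralCLM z₀ hR.le).analyticAt _).comp hprod)) ?_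
  filter_upwards [prod_mem_nhds (ball_mem_nhds z₀ hR) (ball_mem_nhds w₀ hR)] with p hp
  obtain ⟨u, hu, hu'⟩ := hunit p.1 hp.1
  have hku : k p.1 = ↑u⁻¹ := by simp only [k, ← hu, Ring.inverse_unit]
  rw [Pi.smul_apply, Function.comp_apply, circleIntegralCLM_apply (f := fun ζ => (ζ - p.1)⁻¹ • f (ζ, p.2)) hR.le fun ζ => by
    rw [hku, ContinuousMap.mul_apply, hu', hFf _ hp.2, smul_eq_mul]]
  have hd : ∀ z ∈ closedBall z₀ R, DifferentiableAt ℂ (fun z => f (z, p.2)) z := fun z hz =>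
    h₁ (z, p.2) (hsub ⟨hz, ball_subset_closedBall hp.2⟩)
  exact Complex.two_pi_I_inv_smul_circleIntegral_sub_inv_smul_of_differentiable_on_off_countable
    (s := ∅) countable_empty hp.1
    (fun z hz => (hd z hz).continuousAt.continuousWithinAt)
    (fun z hz => hd z (ball_subset_closedBall hz.1))

end Osgood

/-! ### Joint holomorphy of sections that are holomorphic on the slices and along one transversal -/

section SliceFamily

open Filter Metric Set

/-- Every complex number is equivalent modulo `Λ` to one of norm at most `R`, for some `R`. -/
def IsCobounded (Λ : AddSubgroup ℂ) : Prop := ∃ R : ℝ, ∀ z : ℂ, ∃ l ∈ Λ, ‖z + l‖ ≤ R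

/-- Liouville's theorem: all values are already taken on a compact ball. -/
theorem IsCobounded.eq_of_periodic {Λ : AddSubgroup ℂ} (hΛ : IsCobounded Λ) {H : ℂ → ℂ}
    (hd : Differentiable ℂ H) (hp : ∀ l ∈ Λ, ∀ z, H (z + l) = H z) (z w : ℂ) : H z = H w := by
  obtain ⟨R, hR⟩ := hΛ
  refine hd.apply_eq_apply_of_bounded ?_ z w
  refine ((isCompact_closedBall (0 : ℂ) R).image hd.continuous).isBounded.subset ?_
  rintro _ ⟨z, rfl⟩
  obtain ⟨l, hl, hz⟩ := hR z
  exact ⟨z + l, by simpa using hz, hp l hl z⟩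

/-- Holomorphic functions on discs covering `ℂ / Λ` which agree on the overlaps and vanish
at `0` are zero. -/
theorem IsCobounded.eq_zero_of_glue {Λ : AddSubgroup ℂ} (hΛ : IsCobounded Λ) {κ : Type*}
    {c : κ → ℂ} {r : κ → ℝ} (hcov : ∀ z : ℂ, ∃ k, ∃ l ∈ Λ, z + l ∈ ball (c k) (r k))
    {H : κ → ℂ → ℂ} (hd : ∀ k, DifferentiableOn ℂ (H k) (ball (c k) (r k)))
    (hH : ∀ j k, ∀ l ∈ Λ, ∀ z ∈ ball (c j) (r j), z + l ∈ ball (c k) (r k) → H k (z + l) = H j z)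
    {k₀ : κ} (hk₀ : 0 ∈ ball (c k₀) (r k₀)) (h0 : H k₀ 0 = 0) {k : κ} {z : ℂ}
    (hz : z ∈ ball (c k) (r k)) : H k z = 0 := by
  choose K l hl hKl using hcov
  -- The glued function `z ↦ H (K z) (z + l z)` does not depend on the choice of disc and translate;
  -- hence it is entire and periodic.
  have key : ∀ z k, ∀ m ∈ Λ, z + m ∈ ball (c k) (r k) → H (K z) (z + l z) = H k (z + m) := by
    intro z k m hm hz
    have := hH k (K z) (l z - m) (Λ.sub_mem (hl z) hm) (z + m) hz
    rw [show z + m + (l z - m) = z + l z by ring] at this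
    exact this (hKl z)
  have hdiff : Differentiable ℂ fun z => H (K z) (z + l z) := by
    intro z
    have h1 : DifferentiableAt ℂ (fun w => H (K z) (w + l z)) z :=
      ((hd (K z)).differentiableAt (isOpen_ball.mem_nhds (hKl z))).comp z
        (differentiableAt_id.add_const _)
    refine h1.congr_of_eventuallyEq ?_
    have hc : ContinuousAt (fun w => w + l z) z := by fun_prop
    filter_upwards [hc (isOpen_ball.mem_nhds (hKl z))] with w hw
    exact key w _ _ (hl z) hw
  have hper : ∀ m ∈ Λ, ∀ z, H (K (z + m)) (z + m + l (z + m)) = H (K z) (z + l z) := by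
    intro m hm z
    rw [key z (K (z + m)) (m + l (z + m)) (Λ.add_mem hm (hl _)) (by
      rw [← add_assoc]; exact hKl _), add_assoc]
  have e1 := hΛ.eq_of_periodic hdiff hper z 0
  have e2 := key z k 0 Λ.zero_mem (by simpa using hz)
  have e3 := key 0 k₀ 0 Λ.zero_mem (by simpa using hk₀)
  rw [add_zero] at e2 e3
  rw [← e2, e1, e3, h0]

variable {ι : Type*} {Λ : AddSubgroup ℂ} {Ω : ι → Set (ℂ × ℂ)} {f : ι → ℂ × ℂ → ℂ}

/-- The coordinates `f a`, with respect to local frames over `Ω a`, of a nowhere vanishing section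
of a line bundle over `ℂ / Λ × ℂ`, which is holomorphic on each slice `ℂ / Λ × {μ}` and
on `{0} × ℂ`. -/
structure IsSliceFamily (Λ : AddSubgroup ℂ) (Ω : ι → Set (ℂ × ℂ)) (f : ι → ℂ × ℂ → ℂ) : Prop where
  cobounded : IsCobounded Λ
  isOpen : ∀ a, IsOpen (Ω a)
  cover : ∀ p, ∃ a, p ∈ Ω a
  ne_zero : ∀ a, ∀ p ∈ Ω a, f a p ≠ 0
  slice : ∀ a, ∀ p ∈ Ω a, DifferentiableAt ℂ (fun z => f a (z, p.2)) p.1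
  ratio : ∀ a b, ∀ l ∈ Λ, ∀ p ∈ Ω a, (p.1 + l, p.2) ∈ Ω b →
    ContDiffAt ℂ 1 (fun q : ℂ × ℂ => f b (q.1 + l, q.2) / f a q) p
  base : ∀ a μ, (0, μ) ∈ Ω a → DifferentiableAt ℂ (fun ν => f a (0, ν)) μ

/-- Finitely many discs covering `ℂ / Λ` on which coordinates are defined for parameters near
`μ₀`. -/
structure IsDiscCover (Λ : AddSubgroup ℂ) (Ω : ι → Set (ℂ × ℂ)) (μ₀ : ℂ) {κ : Type*} (a : κ → ι)
    (c : κ → ℂ) (r : κ → ℝ) : Prop where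
  pos : ∀ k, 0 < r k
  subset : ∀ k, closedBall (c k) (r k) ×ˢ closedBall μ₀ (r k) ⊆ Ω (a k)
  cover : ∀ z, ∃ k, ∃ l ∈ Λ, z + l ∈ ball (c k) (r k)
  base : ∃ k, 0 ∈ ball (c k) (r k)

/-- Compactness of a ball meeting every class modulo `Λ`. The label `none` is reserved for a disc
about `z₀` carrying the prescribed coordinate `a₀`; the labels `some z` come from the finite
subcover. -/
theorem IsSliceFamily.exists_discCover (h : IsSliceFamily Λ Ω f) {a₀ : ι} {z₀ μ₀ : ℂ}
    (h₀ : (z₀, μ₀) ∈ Ω a₀) : ∃ s : Finset (Option ℂ), ∃ (a : s → ι) (c : s → ℂ) (r : s → ℝ),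
      IsDiscCover Λ Ω μ₀ a c r ∧ ∃ k, a k = a₀ ∧ c k = z₀ := by
  obtain ⟨R, hR⟩ := h.cobounded
  have hloc : ∀ o : Option ℂ, ∃ a : ι, ∃ r : ℝ, 0 < r ∧
      closedBall (o.getD z₀) r ×ˢ closedBall μ₀ r ⊆ Ω a ∧ (o = none → a = a₀) := by
    intro o
    obtain ⟨a, ha, ha'⟩ : ∃ a, (o.getD z₀, μ₀) ∈ Ω a ∧ (o = none → a = a₀) := by
      cases o with
      | none => exact ⟨a₀, h₀, fun _ => rfl⟩
      | some z => obtain ⟨a, ha⟩ := h.cover (z, μ₀); exact ⟨a, ha, by simp⟩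
    obtain ⟨r, hr, hsub⟩ := nhds_basis_closedBall.mem_iff.1 ((h.isOpen a).mem_nhds ha)
    rw [← closedBall_prod_same] at hsub
    exact ⟨a, r, hr, hsub, ha'⟩
  choose a r hr hsub hnone using hloc
  obtain ⟨t, -, ht⟩ := (isCompact_closedBall (0 : ℂ) R).elim_nhds_subcover
    (fun z => ball z (r (some z))) (fun z _ => ball_mem_nhds z (hr _))
  classical
  refine ⟨insert none (t.image some), fun k => a k, fun k => k.1.getD z₀, fun k => r k,
    ⟨fun k => hr k, fun k => hsub k, fun z => ?_, ?_⟩, ⟨none, by simp⟩, hnone none rfl, rfl⟩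
  · obtain ⟨l, hl, hz⟩ := hR z
    obtain ⟨y, hy, hy'⟩ := mem_iUnion₂.1 (ht (show z + l ∈ closedBall (0 : ℂ) R by simpa using hz))
    exact ⟨⟨some y, by simp [hy]⟩, l, hl, hy'⟩
  · have hR0 : 0 ≤ R := by
      obtain ⟨l, -, hl⟩ := hR 0
      exact (norm_nonneg _).trans hl
    obtain ⟨y, hy, hy'⟩ := mem_iUnion₂.1 (ht (show (0 : ℂ) ∈ closedBall (0 : ℂ) R by simpa using hR0))
    exact ⟨⟨some y, by simp [hy]⟩, hy'⟩

/-- The difference quotient of `f a` in the parameter. -/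
def paramSlope (f : ι → ℂ × ℂ → ℂ) (μ₀ : ℂ) (a : ι) (μ z : ℂ) : ℂ :=
  (f a (z, μ) - f a (z, μ₀)) / (μ - μ₀)

/-- The Leibniz rule for difference quotients of `f b = (f b / f a) * f a`. The second summand makes
the gluing of slopes affine rather than linear. -/
theorem IsSliceFamily.paramSlope_eq (h : IsSliceFamily Λ Ω f) {a b : ι} {z l μ μ₀ : ℂ}
    (hμ : (z, μ) ∈ Ω a) (hμ₀ : (z, μ₀) ∈ Ω a) :
    paramSlope f μ₀ b μ (z + l) = f b (z + l, μ) / f a (z, μ) * paramSlope f μ₀ a μ z +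
      (f b (z + l, μ) / f a (z, μ) - f b (z + l, μ₀) / f a (z, μ₀)) / (μ - μ₀) * f a (z, μ₀) := by
  have h1 := h.ne_zero a _ hμ
  have h2 := h.ne_zero a _ hμ₀
  unfold paramSlope
  rcases eq_or_ne (μ - μ₀) 0 with h0 | h0
  · simp [h0]
  · field_simp
    ring

theorem IsSliceFamily.hasDerivAt_ratio (h : IsSliceFamily Λ Ω f) {a b : ι} {z l μ₀ : ℂ}
    (hl : l ∈ Λ) (ha : (z, μ₀) ∈ Ω a) (hb : (z + l, μ₀) ∈ Ω b) :
    ∃ g', HasDerivAt (fun μ => f b (z + l, μ) / f a (z, μ)) g' μ₀ := by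
  have h1 := ((h.ratio a b l hl (z, μ₀) ha hb).differentiableAt one_ne_zero).comp (μ₀ : ℂ)
    (f := fun μ : ℂ => (z, μ)) (by fun_prop)
  exact ⟨_, h1.hasDerivAt⟩

variable {κ : Type*} {a : κ → ι} {c : κ → ℂ} {r : κ → ℝ} {μ₀ : ℂ}

theorem Ultrafilter.eventually_eq_of_finite {α κ : Type*} [Finite κ] (U : Ultrafilter α)
    (K : α → κ) : ∃ k, ∀ᶠ x in (U : Filter α), K x = k := by
  have h := (Ultrafilter.finite_biUnion_mem_iff (f := U) (s := fun k : κ => {x | K x = k})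
    (Set.finite_univ)).1 (by
      have : ⋃ k ∈ (Set.univ : Set κ), {x | K x = k} = Set.univ := by ext; simp
      rw [this]
      exact Filter.univ_mem)
  obtain ⟨k, -, hk⟩ := h
  exact ⟨k, hk⟩

/-- The limit along an ultrafilter of the (normalised) difference quotients of a slice family. -/
structure IsSlopeLimit (f : ι → ℂ × ℂ → ℂ) (μ₀ : ℂ) (a : κ → ι) (c : κ → ℂ) (r : κ → ℝ)
    (U : Ultrafilter ℂ) (η : ℂ → ℂ) (W : κ → ℂ → ℂ) : Prop where
  differentiableOn : ∀ k, DifferentiableOn ℂ (W k) (ball (c k) (r k))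
  tendsto : ∀ k, TendstoLocallyUniformlyOn (fun μ z => η μ * paramSlope f μ₀ (a k) μ z) (W k) U
    (ball (c k) (r k))

theorem IsDiscCover.mem (hc : IsDiscCover Λ Ω μ₀ a c r) {k : κ} {z μ : ℂ}
    (hz : z ∈ ball (c k) (r k)) (hμ : μ ∈ closedBall μ₀ (r k)) : (z, μ) ∈ Ω (a k) :=
  hc.subset k ⟨ball_subset_closedBall hz, hμ⟩

theorem IsDiscCover.mem_base (hc : IsDiscCover Λ Ω μ₀ a c r) {k : κ} {z : ℂ}
    (hz : z ∈ ball (c k) (r k)) : (z, μ₀) ∈ Ω (a k) :=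
  hc.mem hz (mem_closedBall_self (hc.pos k).le)

theorem IsDiscCover.eventually_mem (hc : IsDiscCover Λ Ω μ₀ a c r) {U : Ultrafilter ℂ}
    (hU : (U : Filter ℂ) ≤ 𝓝[≠] μ₀) (k : κ) :
    ∀ᶠ μ in (U : Filter ℂ), μ ∈ closedBall μ₀ (r k) :=
  (hU.trans nhdsWithin_le_nhds) (closedBall_mem_nhds μ₀ (hc.pos k))

/-- The limit of `paramSlope_eq` multiplied by `η`. The inhomogeneous term depends on the
ultrafilter only through `t`, so it cancels between two limits with the same `t`. -/
theorem IsSlopeLimit.apply_add (hf : IsSliceFamily Λ Ω f) (hc : IsDiscCover Λ Ω μ₀ a c r)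
    {U : Ultrafilter ℂ} (hU : (U : Filter ℂ) ≤ 𝓝[≠] μ₀) {η : ℂ → ℂ} {W : κ → ℂ → ℂ} {t : ℂ}
    (ht : Tendsto η U (𝓝 t)) (hW : IsSlopeLimit f μ₀ a c r U η W) {j k : κ} {l z g' : ℂ}
    (hz : z ∈ ball (c j) (r j)) (hz' : z + l ∈ ball (c k) (r k))
    (hg : HasDerivAt (fun μ => f (a k) (z + l, μ) / f (a j) (z, μ)) g' μ₀) :
    W k (z + l) = f (a k) (z + l, μ₀) / f (a j) (z, μ₀) * W j z +
      t * (g' * f (a j) (z, μ₀)) := by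
  have h1 := (hW.tendsto k).tendsto_at hz'
  have h2 := (hW.tendsto j).tendsto_at hz
  have h3 : Tendsto (fun μ => f (a k) (z + l, μ) / f (a j) (z, μ)) U
      (𝓝 (f (a k) (z + l, μ₀) / f (a j) (z, μ₀))) :=
    hg.continuousAt.tendsto.mono_left (hU.trans nhdsWithin_le_nhds)
  have h4 := (hasDerivAt_iff_tendsto_slope.1 hg).mono_left hU
  refine tendsto_nhds_unique h1 (((h3.mul h2).add (ht.mul (h4.mul_const _))).congr' ?_)
  filter_upwards [hc.eventually_mem hU j] with μ hμ
  rw [hf.paramSlope_eq (hc.mem hz hμ) (hc.mem_base hz), slope_def_field]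
  ring

/-- Holomorphy along `{0} × ℂ` enters here: it fixes the value at `0`, and thereby the one constant
left free by the gluing relation. -/
theorem IsSlopeLimit.apply_zero (hf : IsSliceFamily Λ Ω f) (hc : IsDiscCover Λ Ω μ₀ a c r)
    {U : Ultrafilter ℂ} (hU : (U : Filter ℂ) ≤ 𝓝[≠] μ₀) {η : ℂ → ℂ} {W : κ → ℂ → ℂ} {t : ℂ}
    (ht : Tendsto η U (𝓝 t)) (hW : IsSlopeLimit f μ₀ a c r U η W) {k : κ}
    (hk : 0 ∈ ball (c k) (r k)) :
    W k 0 = t * deriv (fun ν => f (a k) (0, ν)) μ₀ := by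
  have h1 := (hW.tendsto k).tendsto_at hk
  have h4 := (hasDerivAt_iff_tendsto_slope.1
    (hf.base (a k) μ₀ (hc.mem_base hk)).hasDerivAt).mono_left hU
  refine tendsto_nhds_unique h1 ((ht.mul h4).congr fun μ => ?_)
  rw [slope_def_field]
  rfl

theorem IsSliceFamily.differentiableOn_base (hf : IsSliceFamily Λ Ω f)
    (hc : IsDiscCover Λ Ω μ₀ a c r) (k : κ) :
    DifferentiableOn ℂ (fun z => f (a k) (z, μ₀)) (ball (c k) (r k)) := fun z hz =>
  (hf.slice (a k) (z, μ₀) (hc.mem_base hz)).differentiableWithinAt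

/-- A slope limit along two ultrafilters is the same; and it is zero if `η` tends to `0`. -/
theorem IsSlopeLimit.eqOn (hf : IsSliceFamily Λ Ω f) (hc : IsDiscCover Λ Ω μ₀ a c r)
    {U U' : Ultrafilter ℂ} (hU : (U : Filter ℂ) ≤ 𝓝[≠] μ₀) (hU' : (U' : Filter ℂ) ≤ 𝓝[≠] μ₀)
    {η η' : ℂ → ℂ} {W W' : κ → ℂ → ℂ} {t : ℂ}
    (ht : Tendsto η U (𝓝 t)) (hW : IsSlopeLimit f μ₀ a c r U η W)
    (ht' : Tendsto η' U' (𝓝 t)) (hW' : IsSlopeLimit f μ₀ a c r U' η' W')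
    {k : κ} {z : ℂ} (hz : z ∈ ball (c k) (r k)) : W k z = W' k z := by
  obtain ⟨k₀, hk₀⟩ := hc.base
  have hne : ∀ k, ∀ z ∈ ball (c k) (r k), f (a k) (z, μ₀) ≠ 0 := fun k z hz =>
    hf.ne_zero _ _ (hc.mem_base hz)
  -- The difference of the limits is a section over the slice at `μ₀`; dividing by the nowhere
  -- vanishing section `f (a k) (·, μ₀)` gives a function on `ℂ / Λ` vanishing at `0`.
  have h := hf.cobounded.eq_zero_of_glue hc.cover
    (H := fun k z => (W k z - W' k z) / f (a k) (z, μ₀))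
    (fun k => ((hW.differentiableOn k).sub (hW'.differentiableOn k)).div
      (hf.differentiableOn_base hc k) (hne k)) ?_ hk₀ ?_ hz
  · exact sub_eq_zero.1 ((div_eq_zero_iff.1 h).resolve_right (hne k z hz))
  · intro j k l hl z hz hz'
    obtain ⟨g', hg⟩ := hf.hasDerivAt_ratio hl (hc.mem_base hz) (hc.mem_base hz')
    rw [hW.apply_add hf hc hU ht hz hz' hg, hW'.apply_add hf hc hU' ht' hz hz' hg]
    have e1 := hne k _ hz'
    have e2 := hne j _ hz
    field_simp
    ring
  · rw [hW.apply_zero hf hc hU ht hk₀, hW'.apply_zero hf hc hU' ht' hk₀, sub_self, zero_div]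

/-- The comparison term for `t = 0`: by `IsSlopeLimit.eqOn`, every slope limit with `η → 0` agrees
with this one and vanishes. -/
theorem isSlopeLimit_zero (U : Ultrafilter ℂ) : IsSlopeLimit f μ₀ a c r U 0 0 where
  differentiableOn k := differentiableOn_const 0
  tendsto k := by
    rw [tendstoLocallyUniformlyOn_iff]
    intro ε hε z hz
    exact ⟨_, self_mem_nhdsWithin, by simp [hε]⟩

/-- The point at which the difference quotients on the discs have maximal modulus. -/
theorem IsSliceFamily.exists_max [Finite κ] (hf : IsSliceFamily Λ Ω f)
    (hc : IsDiscCover Λ Ω μ₀ a c r) {μ : ℂ} (hμ : ∀ k, μ ∈ closedBall μ₀ (r k)) :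
    ∃ k₀ z₀, z₀ ∈ closedBall (c k₀) (r k₀) ∧ ∀ k, ∀ z ∈ closedBall (c k) (r k),
      ‖paramSlope f μ₀ (a k) μ z‖ ≤ ‖paramSlope f μ₀ (a k₀) μ z₀‖ := by
  have hcont : ∀ k, ContinuousOn (fun z => ‖paramSlope f μ₀ (a k) μ z‖)
      (closedBall (c k) (r k)) := by
    intro k z hz
    refine ContinuousAt.continuousWithinAt (ContinuousAt.norm (ContinuousAt.div_const ?_ _))
    exact ((hf.slice (a k) (z, μ) (hc.subset k ⟨hz, hμ k⟩)).continuousAt).sub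
      ((hf.slice (a k) (z, μ₀)
        (hc.subset k ⟨hz, mem_closedBall_self (hc.pos k).le⟩)).continuousAt)
  have hmax := fun k => (isCompact_closedBall (c k) (r k)).exists_isMaxOn
    ⟨c k, mem_closedBall_self (hc.pos k).le⟩ (hcont k)
  choose Z hZ hmaxZ using hmax
  obtain ⟨k₁, -⟩ := hc.base
  have : Nonempty κ := ⟨k₁⟩
  obtain ⟨k₀, hk₀⟩ := Finite.exists_max fun k => ‖paramSlope f μ₀ (a k) μ (Z k)‖
  exact ⟨k₀, Z k₀, hZ k₀, fun k z hz => (hmaxZ k hz).trans (hk₀ k)⟩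

/-- If the difference quotients, multiplied by `η → 0`, tend to `0` locally uniformly on the open
discs, then they tend to `0` along points of the closed discs. -/
theorem IsSlopeLimit.tendsto_zero (hf : IsSliceFamily Λ Ω f) (hc : IsDiscCover Λ Ω μ₀ a c r)
    {U : Ultrafilter ℂ} (hU : (U : Filter ℂ) ≤ 𝓝[≠] μ₀) {η : ℂ → ℂ} {W : κ → ℂ → ℂ}
    (ht : Tendsto η U (𝓝 0)) (hW : IsSlopeLimit f μ₀ a c r U η W) {k : κ} {Z : ℂ → ℂ} {z : ℂ}
    (hz : z ∈ closedBall (c k) (r k)) (hZ : Tendsto Z U (𝓝 z)) :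
    Tendsto (fun μ => η μ * paramSlope f μ₀ (a k) μ (Z μ)) U (𝓝 0) := by
  -- The point `z` may lie on the boundary of its disc, where locally uniform convergence says
  -- nothing; a translate of it is interior to another disc, and the estimate is carried back by the
  -- transition function.
  obtain ⟨m, l, hl, hzl⟩ := hc.cover z
  have hWm : W m (z + l) = 0 :=
    hW.eqOn hf hc hU hU ht (tendsto_const_nhds (x := (0 : ℂ)))
      (isSlopeLimit_zero (f := f) (μ₀ := μ₀) (a := a) (c := c) (r := r) U) hzl
  have hZl : Tendsto (fun μ => Z μ + l) U (𝓝 (z + l)) := hZ.add_const l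
  have hZl' : ∀ᶠ μ in (U : Filter ℂ), Z μ + l ∈ ball (c m) (r m) :=
    hZl (isOpen_ball.mem_nhds hzl)
  have hU' : Tendsto (fun μ : ℂ => μ) U (𝓝 μ₀) := hU.trans nhdsWithin_le_nhds
  have hw : Tendsto (fun μ => η μ * paramSlope f μ₀ (a m) μ (Z μ + l)) U (𝓝 0) := by
    rw [← hWm]
    exact (hW.tendsto m).tendsto_comp ((hW.differentiableOn m).continuousOn _ hzl) hzl
      (tendsto_nhdsWithin_iff.2 ⟨hZl, hZl'⟩)
  have hmem : (z + l + -l, μ₀) ∈ Ω (a k) := by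
    rw [add_neg_cancel_right]
    exact hc.subset k ⟨hz, mem_closedBall_self (hc.pos k).le⟩
  have hG := hf.ratio (a m) (a k) (-l) (Λ.neg_mem hl) (z + l, μ₀) (hc.mem_base hzl) hmem
  set G : ℂ × ℂ → ℂ := fun q => f (a k) (q.1 + -l, q.2) / f (a m) q with hGdef
  have hp : Tendsto (fun μ => (Z μ + l, μ)) U (𝓝 (z + l, μ₀)) := hZl.prodMk_nhds hU'
  have hp₀ : Tendsto (fun μ => (Z μ + l, μ₀)) U (𝓝 (z + l, μ₀)) :=
    hZl.prodMk_nhds tendsto_const_nhds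
  have hGt : Tendsto (fun μ => G (Z μ + l, μ)) U (𝓝 (G (z + l, μ₀))) :=
    hG.continuousAt.tendsto.comp hp
  have hft : Tendsto (fun μ => f (a m) (Z μ + l, μ₀)) U (𝓝 (f (a m) (z + l, μ₀))) :=
    ((hf.slice (a m) (z + l, μ₀) (hc.mem_base hzl)).continuousAt.tendsto).comp hZl
  -- The base point `Z μ + l` moves with `μ`, so differentiability of `G` at one point would not
  -- suffice; being `C¹`, `G` is strictly differentiable and its difference quotients in `μ` are
  -- bounded near `(z + l, μ₀)`.
  obtain ⟨C, hC⟩ := ((hG.hasStrictFDerivAt one_ne_zero).isBigO_sub.comp_tendsto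
    (hp.prodMk_nhds hp₀)).bound
  have hsmall : Tendsto (fun μ => η μ * ((G (Z μ + l, μ) - G (Z μ + l, μ₀)) / (μ - μ₀) *
      f (a m) (Z μ + l, μ₀))) U (𝓝 0) := by
    refine squeeze_zero_norm' (a := fun μ => ‖η μ‖ * (C * ‖f (a m) (Z μ + l, μ₀)‖)) ?_ ?_
    · filter_upwards [hC, hU self_mem_nhdsWithin] with μ hμ hne
      have hne' : 0 < ‖μ - μ₀‖ := norm_pos_iff.2 (sub_ne_zero.2 hne)
      rw [norm_mul, norm_mul, norm_div]
      gcongr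
      rw [div_le_iff₀ hne']
      simpa [Prod.norm_def] using hμ
    · simpa using ht.norm.mul (hft.norm.const_mul C)
  have := (hGt.mul hw).add hsmall
  rw [mul_zero, add_zero] at this
  refine this.congr' ?_
  filter_upwards [hZl', hc.eventually_mem hU m] with μ hμ hμ'
  have := hf.paramSlope_eq (b := a k) (l := -l) (hc.mem hμ hμ') (hc.mem_base hμ)
  rw [add_neg_cancel_right] at this
  rw [this]
  simp only [hGdef, add_neg_cancel_right]
  ring

/-- Along every ultrafilter, the difference quotients converge locally uniformly. -/
theorem IsSliceFamily.exists_isSlopeLimit [Finite κ] (hf : IsSliceFamily Λ Ω f)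
    (hc : IsDiscCover Λ Ω μ₀ a c r) {U : Ultrafilter ℂ} (hU : (U : Filter ℂ) ≤ 𝓝[≠] μ₀) :
    ∃ V, IsSlopeLimit f μ₀ a c r U 1 V := by
  obtain ⟨k₁, -⟩ := hc.base
  have : Nonempty κ := ⟨k₁⟩
  have hmem : ∀ᶠ μ in (U : Filter ℂ), ∀ k, μ ∈ closedBall μ₀ (r k) :=
    eventually_all.2 (hc.eventually_mem hU)
  have hmax := fun μ (hμ : ∀ k, μ ∈ closedBall μ₀ (r k)) => hf.exists_max hc hμ
  choose! K Z hZ hle using hmax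
  set N : ℂ → ℝ := fun μ => ‖paramSlope f μ₀ (a (K μ)) μ (Z μ)‖ with hN
  have hN0 : ∀ μ, 0 ≤ N μ := fun μ => norm_nonneg _
  -- With this normalisation the slopes times `η` are bounded by `1`, and `η * N = 1 - η`: if `η`
  -- tends to `0`, the normalised maximum tends to `1`.
  set η : ℂ → ℝ := fun μ => 1 / (1 + N μ) with hη
  have hη0 : ∀ μ, 0 < η μ := fun μ => by have := hN0 μ; simp only [hη]; positivity
  have hηN : ∀ μ, η μ * N μ = 1 - η μ := fun μ => by
    have := hN0 μ
    simp only [hη]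
    field_simp
    ring
  have hη1 : ∀ μ, η μ ∈ Icc (0 : ℝ) 1 := fun μ =>
    ⟨(hη0 μ).le, by have := hηN μ; nlinarith [hN0 μ, hη0 μ]⟩
  obtain ⟨t, ht01, ht⟩ := (isCompact_Icc (a := (0 : ℝ)) (b := 1)).ultrafilter_le_nhds (U.map η)
    (Filter.le_principal_iff.2
      (Filter.Eventually.of_forall (f := (U : Filter ℂ)) hη1))
  have ht' : Tendsto (fun μ => (η μ : ℂ)) U (𝓝 (t : ℂ)) :=
    (Complex.continuous_ofReal.tendsto t).comp ht
  have hbound : ∀ k, ∀ᶠ μ in (U : Filter ℂ), ∀ z ∈ ball (c k) (r k),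
      ‖(η μ : ℂ) * paramSlope f μ₀ (a k) μ z‖ ≤ 1 := by
    intro k
    filter_upwards [hmem] with μ hμ z hz
    rw [norm_mul, Complex.norm_real, Real.norm_of_nonneg (hη0 μ).le]
    have h1 := mul_le_mul_of_nonneg_left (hle μ hμ k z (ball_subset_closedBall hz)) (hη0 μ).le
    have h2 := hηN μ
    have h3 := hη0 μ
    simp only [hN] at h2
    linarith
  have hdiff : ∀ k, ∀ᶠ μ in (U : Filter ℂ), DifferentiableOn ℂ
      (fun z => (η μ : ℂ) * paramSlope f μ₀ (a k) μ z) (ball (c k) (r k)) := by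
    intro k
    filter_upwards [hmem] with μ hμ z hz
    refine DifferentiableAt.differentiableWithinAt (DifferentiableAt.const_mul
      (DifferentiableAt.div_const ?_ _) _)
    exact (hf.slice (a k) (z, μ) (hc.mem hz (hμ k))).sub
      (hf.slice (a k) (z, μ₀) (hc.mem_base hz))
  have hlim := fun k => exists_tendstoLocallyUniformlyOn_of_bounded U (hdiff k) (hbound k)
  choose W hWd hWt using hlim
  have hW : IsSlopeLimit f μ₀ a c r U (fun μ => (η μ : ℂ)) W := ⟨hWd, hWt⟩
  have ht0 : t ≠ 0 := by
    rintro rfl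
    rw [Complex.ofReal_zero] at ht'
    -- If `t = 0`, the maximum is attained along `U` on one fixed disc, at points converging in the
    -- closed disc. There the normalised slopes tend to `0` by `tendsto_zero`, against `η * N → 1`.
    obtain ⟨k, hk⟩ := U.eventually_eq_of_finite K
    have hZk : ∀ᶠ μ in (U : Filter ℂ), Z μ ∈ closedBall (c k) (r k) := by
      filter_upwards [hk, hmem] with μ h1 h2
      rw [← h1]
      exact hZ μ h2
    obtain ⟨z, hz, hzt⟩ := (isCompact_closedBall (c k) (r k)).ultrafilter_le_nhds (U.map Z)
      (Filter.le_principal_iff.2 hZk)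
    have h0 := (hW.tendsto_zero hf hc hU ht' hz hzt).norm
    have h1 : Tendsto (fun μ => 1 - η μ) U (𝓝 (1 - 0)) := Tendsto.const_sub 1 ht
    rw [norm_zero] at h0
    rw [sub_zero] at h1
    refine zero_ne_one (tendsto_nhds_unique h0 (h1.congr' ?_))
    filter_upwards [hk] with μ hμ
    rw [norm_mul, Complex.norm_real, Real.norm_of_nonneg (hη0 μ).le, ← hηN μ, hN, ← hμ]
  have ht0' : (t : ℂ) ≠ 0 := Complex.ofReal_ne_zero.2 ht0
  -- Since `η → t ≠ 0`, the normalisation can be divided out again.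
  refine ⟨fun k z => (t : ℂ)⁻¹ * W k z, fun k => (hWd k).const_mul _, fun k => ?_⟩
  have h1 : TendstoLocallyUniformlyOn (fun μ _ => ((η μ : ℂ))⁻¹) (fun _ : ℂ => (t : ℂ)⁻¹) U
      (ball (c k) (r k)) := by
    refine TendstoUniformlyOn.tendstoLocallyUniformlyOn ?_
    rw [Metric.tendstoUniformlyOn_iff]
    intro ε hε
    filter_upwards [(ht'.inv₀ ht0') (Metric.ball_mem_nhds _ hε)] with μ hμ _ _
    rw [dist_comm]
    exact hμ
  have h2 := h1.mul₀ (hWt k) continuousOn_const (hWd k).continuousOn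
  refine h2.congr fun μ z hz => ?_
  have := hη0 μ
  simp only [Pi.mul_apply, Pi.one_apply, one_mul]
  rw [inv_mul_cancel_left₀ (Complex.ofReal_ne_zero.2 this.ne')]

/-- Slopes converge along every ultrafilter finer than `𝓝[≠] μ₀`, and all limits agree by
`IsSlopeLimit.eqOn` with `η = 1`. Local uniformity in `z` makes the limit a joint one in `(z, μ)`.
-/
theorem IsSliceFamily.exists_tendsto_paramSlope (hf : IsSliceFamily Λ Ω f) {a : ι} {z₀ μ₀ : ℂ}
    (h₀ : (z₀, μ₀) ∈ Ω a) : ∃ v : ℂ, Tendsto (fun p : ℂ × ℂ => paramSlope f μ₀ a p.2 p.1)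
      (𝓝 z₀ ×ˢ 𝓝[≠] μ₀) (𝓝 v) := by
  obtain ⟨s, A, c, r, hc, k, hkA, hkc⟩ := hf.exists_discCover h₀
  have hz : z₀ ∈ ball (c k) (r k) := by rw [hkc]; exact mem_ball_self (hc.pos k)
  have hlim := fun (U : Ultrafilter ℂ) (hU : (U : Filter ℂ) ≤ 𝓝[≠] μ₀) =>
    hf.exists_isSlopeLimit hc hU
  choose V hV using hlim
  let U₀ : Ultrafilter ℂ := Ultrafilter.of (𝓝[≠] μ₀)
  have hU₀ : (U₀ : Filter ℂ) ≤ 𝓝[≠] μ₀ := Ultrafilter.of_le _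
  refine ⟨V U₀ hU₀ k z₀, tendsto_iff_ultrafilter _ _ _ |>.2 fun 𝒰 h𝒰 => ?_⟩
  have hU : ((𝒰.map Prod.snd : Ultrafilter ℂ) : Filter ℂ) ≤ 𝓝[≠] μ₀ :=
    (Filter.map_mono h𝒰).trans tendsto_snd
  have h1 : Tendsto (fun p : ℂ × ℂ => p.1) 𝒰 (𝓝 z₀) := (tendsto_fst).mono_left h𝒰
  have hone : ∀ U : Ultrafilter ℂ, Tendsto (1 : ℂ → ℂ) U (𝓝 1) := fun U => tendsto_const_nhds
  -- An ultrafilter on pairs is handled through its projection to `μ`: the limit for the reference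
  -- ultrafilter `U₀` is replaced by the limit for that projection.
  rw [(hV U₀ hU₀).eqOn hf hc hU₀ hU (hone _) (hone _) (hV _ hU) hz]
  have h2 := (hV _ hU).tendsto k
  have h3 : TendstoLocallyUniformlyOn (fun (p : ℂ × ℂ) z => (1 : ℂ → ℂ) p.2 *
      paramSlope f μ₀ (A k) p.2 z) (V _ hU k) 𝒰 (ball (c k) (r k)) := by
    intro u hu x hx
    obtain ⟨t, ht, hev⟩ := h2 u hu x hx
    exact ⟨t, ht, hev⟩
  have h4 := h3.tendsto_comp (((hV _ hU).differentiableOn k).continuousOn _ hz) hz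
    (tendsto_nhdsWithin_iff.2 ⟨h1, h1 (isOpen_ball.mem_nhds hz)⟩)
  simpa [hkA] using h4

theorem IsSliceFamily.differentiableAt_param (hf : IsSliceFamily Λ Ω f) {a : ι} {p : ℂ × ℂ}
    (hp : p ∈ Ω a) : DifferentiableAt ℂ (fun μ => f a (p.1, μ)) p.2 := by
  obtain ⟨v, hv⟩ := hf.exists_tendsto_paramSlope hp
  suffices h : HasDerivAt (fun μ => f a (p.1, μ)) v p.2 from h.differentiableAt
  rw [hasDerivAt_iff_tendsto_slope]
  refine (hv.comp (tendsto_const_nhds.prodMk tendsto_id)).congr fun μ => ?_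
  rw [slope_def_field]
  rfl

/-- For `μ ≠ μ₀`, `f a (z, μ) = f a (z, μ₀) + (μ - μ₀) * paramSlope f μ₀ a μ z`, where the slope has
a finite joint limit. The line `μ = μ₀` is treated separately, by continuity on the slice. -/
theorem IsSliceFamily.continuousAt (hf : IsSliceFamily Λ Ω f) {a : ι} {p : ℂ × ℂ}
    (hp : p ∈ Ω a) : ContinuousAt (f a) p := by
  obtain ⟨z₀, μ₀⟩ := p
  obtain ⟨v, hv⟩ := hf.exists_tendsto_paramSlope hp
  have hbase : ContinuousAt (fun z => f a (z, μ₀)) z₀ := (hf.slice a _ hp).continuousAt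
  have h1 : Tendsto (f a) (𝓝 z₀ ×ˢ 𝓝[≠] μ₀) (𝓝 (f a (z₀, μ₀))) := by
    have h2 : Tendsto (fun p : ℂ × ℂ => p.2 - μ₀) (𝓝 z₀ ×ˢ 𝓝[≠] μ₀) (𝓝 0) := by
      rw [← sub_self μ₀]
      exact (tendsto_snd.mono_right nhdsWithin_le_nhds).sub_const μ₀
    have h3 := (hbase.tendsto.comp (tendsto_fst (g := 𝓝[≠] μ₀))).add (h2.mul hv)
    rw [zero_mul, add_zero] at h3
    refine h3.congr' ?_
    filter_upwards [tendsto_snd (f := 𝓝 z₀) (self_mem_nhdsWithin (a := μ₀) (s := {μ₀}ᶜ))]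
      with p hp
    have : p.2 - μ₀ ≠ 0 := sub_ne_zero.2 hp
    simp only [paramSlope, Function.comp_apply]
    field_simp
    ring
  have h2 : Tendsto (f a) (𝓝 z₀ ×ˢ pure μ₀) (𝓝 (f a (z₀, μ₀))) := by
    rw [prod_pure, tendsto_map'_iff]
    exact hbase
  have h3 := h2.sup h1
  rwa [← Filter.prod_sup, pure_sup_nhdsNE, ← nhds_prod_eq] at h3

/-- A nowhere vanishing section of a holomorphic line bundle over `ℂ / Λ × ℂ` is holomorphic if it
is holomorphic on each slice `ℂ / Λ × {μ}` and on `{0} × ℂ`. -/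
theorem IsSliceFamily.analyticAt (hf : IsSliceFamily Λ Ω f) {a : ι} {p : ℂ × ℂ}
    (hp : p ∈ Ω a) : AnalyticAt ℂ (f a) p :=
  analyticAt_of_separately (hf.isOpen a) (fun _ h => (hf.continuousAt h).continuousWithinAt)
    (hf.slice a) (fun _ h => hf.differentiableAt_param h) hp

end SliceFamily

/-! ### Frames along maps -/

namespace HolLineBundle

open Filter

variable {E H : Type} [NormedAddCommGroup E] [NormedSpace ℂ E] [TopologicalSpace H]
  {I : ModelWithCorners ℂ E H} {X : Type} [TopologicalSpace X] [ChartedSpace H X]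
  {E' H' : Type} [NormedAddCommGroup E'] [NormedSpace ℂ E'] [TopologicalSpace H']
  {I' : ModelWithCorners ℂ E' H'} {Y : Type} [TopologicalSpace Y] [ChartedSpace H' Y]
  {F K : Type} [NormedAddCommGroup F] [NormedSpace ℂ F] [TopologicalSpace K]
  {J : ModelWithCorners ℂ F K} {W : Type} [TopologicalSpace W] [ChartedSpace K W]
  (L L' : HolLineBundle I X)

/-- The total space of a line bundle. -/
abbrev Tot : Type := TotalSpace ℂ L.Fiber

/-- `v' = c • v` for elements of the total space, lying in the same fibre. -/
def SMulRel {x x' : X} (v : L.Fiber x) (v' : L.Fiber x') (c : ℂ) : Prop :=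
  (⟨x', v'⟩ : L.Tot) = ⟨x, c • v⟩

variable {L L'}

theorem SMulRel.proj_eq {x x' : X} {v : L.Fiber x} {v' : L.Fiber x'} {c : ℂ}
    (h : L.SMulRel v v' c) : x' = x :=
  congrArg TotalSpace.proj h

theorem smulRel_iff {x : X} {v v' : L.Fiber x} {c : ℂ} : L.SMulRel v v' c ↔ v' = c • v :=
  ⟨fun h => by simpa [SMulRel] using h, fun h => by rw [SMulRel, h]⟩

theorem smulRel_smul {x : X} (v : L.Fiber x) (c : ℂ) : L.SMulRel v (c • v) c := rfl

theorem SMulRel.trans {x x' x'' : X} {v : L.Fiber x} {v' : L.Fiber x'} {v'' : L.Fiber x''}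
    {c c' : ℂ} (h : L.SMulRel v v' c) (h' : L.SMulRel v' v'' c') : L.SMulRel v v'' (c' * c) := by
  obtain rfl := h.proj_eq
  obtain rfl := h'.proj_eq
  rw [smulRel_iff] at *
  rw [h', h, smul_smul]

theorem SMulRel.symm {x x' : X} {v : L.Fiber x} {v' : L.Fiber x'} {c : ℂ}
    (h : L.SMulRel v v' c) (hc : c ≠ 0) : L.SMulRel v' v c⁻¹ := by
  obtain rfl := h.proj_eq
  rw [smulRel_iff] at *
  rw [h, inv_smul_smul₀ hc]

theorem SMulRel.unique {x x' : X} {v : L.Fiber x} {v' : L.Fiber x'} {c c' : ℂ}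
    (h : L.SMulRel v v' c) (h' : L.SMulRel v v' c') (hv : v ≠ 0) : c = c' := by
  obtain rfl := h.proj_eq
  rw [smulRel_iff] at *
  exact smul_left_injective ℂ hv (h.symm.trans h')

theorem coord_smul (e : L.Triv) {x : X} (hx : x ∈ e.1.baseSet) (c : ℂ) (v : L.Fiber x) :
    (e.1 ⟨x, c • v⟩).2 = c * (e.1 ⟨x, v⟩).2 := (e.1.linear ℂ hx).map_smul c v

theorem coord_ne_zero (e : L.Triv) {x : X} (hx : x ∈ e.1.baseSet) {v : L.Fiber x} (hv : v ≠ 0) :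
    (e.1 ⟨x, v⟩).2 ≠ 0 := by
  intro h
  exact hv ((e.1.linearEquivAt ℂ x hx).map_eq_zero_iff.1 h)

theorem exists_smulRel {x x' : X} (hx : x' = x) {v : L.Fiber x} (hv : v ≠ 0) (v' : L.Fiber x') :
    ∃ c, L.SMulRel v v' c := by
  subst hx
  have hx := mem_baseSet_trivializationAt ℂ L.Fiber x'
  refine ⟨((L.trivAt x').1 ⟨x', v'⟩).2 / ((L.trivAt x').1 ⟨x', v⟩).2, smulRel_iff.2 ?_⟩
  refine ((L.trivAt x').1.linearEquivAt ℂ x' hx).injective ?_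
  change ((L.trivAt x').1 ⟨x', v'⟩).2 = ((L.trivAt x').1 ⟨x', _ • v⟩).2
  rw [coord_smul _ hx, div_mul_cancel₀ _ (coord_ne_zero _ hx hv)]

theorem coord_eq_of_smulRel (e : L.Triv) {x x' : X} (hx : x ∈ e.1.baseSet) {v : L.Fiber x}
    {v' : L.Fiber x'} {c : ℂ} (h : L.SMulRel v v' c) :
    (e.1 ⟨x', v'⟩).2 = c * (e.1 ⟨x, v⟩).2 := by
  rw [h, coord_smul e hx]

theorem contMDiffAt_tot {S : W → L.Tot} {w : W} (e : L.Triv) (he : (S w).proj ∈ e.1.baseSet) :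
    ContMDiffAt J (I.prod 𝓘(ℂ, ℂ)) ω S w ↔ ContMDiffAt J I ω (fun w => (S w).proj) w ∧
      ContMDiffAt J 𝓘(ℂ, ℂ) ω (fun w => (e.1 (S w)).2) w :=
  e.1.contMDiffAt_iff (e.1.mem_source.2 he)

/-- Scalar multiplication on the total space. -/
theorem contMDiffAt_smul {S : W → L.Tot} {c : W → ℂ} {w : W}
    (hc : ContMDiffAt J 𝓘(ℂ, ℂ) ω c w) (hS : ContMDiffAt J (I.prod 𝓘(ℂ, ℂ)) ω S w) :
    ContMDiffAt J (I.prod 𝓘(ℂ, ℂ)) ω (fun w => (⟨(S w).proj, c w • (S w).2⟩ : L.Tot)) w := by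
  have hx : (S w).proj ∈ (L.trivAt (S w).proj).1.baseSet := mem_baseSet_trivializationAt _ _ _
  obtain ⟨h1, h2⟩ := (contMDiffAt_tot _ hx).1 hS
  refine (contMDiffAt_tot (S := fun w => (⟨(S w).proj, c w • (S w).2⟩ : L.Tot)) _ hx).2
    ⟨h1, (hc.mul h2).congr_of_eventuallyEq ?_⟩
  filter_upwards [h1.continuousAt ((L.trivAt (S w).proj).1.open_baseSet.mem_nhds hx)] with y hy
  exact coord_smul _ hy _ _

/-- The quotient of two maps to the total space is holomorphic. -/
theorem contMDiffAt_of_smul_eq {S S' : W → L.Tot} {c : W → ℂ} {w : W}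
    (hS : ContMDiffAt J (I.prod 𝓘(ℂ, ℂ)) ω S w) (hS' : ContMDiffAt J (I.prod 𝓘(ℂ, ℂ)) ω S' w)
    (h0 : (S w).2 ≠ 0) (h : ∀ᶠ y in 𝓝 w, L.SMulRel (S y).2 (S' y).2 (c y)) :
    ContMDiffAt J 𝓘(ℂ, ℂ) ω c w := by
  have hx : (S w).proj ∈ (L.trivAt (S w).proj).1.baseSet := mem_baseSet_trivializationAt _ _ _
  have hx' : (S' w).proj ∈ (L.trivAt (S w).proj).1.baseSet := by
    rwa [h.self_of_nhds.proj_eq]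
  obtain ⟨h1, h2⟩ := (contMDiffAt_tot _ hx).1 hS
  obtain ⟨-, h2'⟩ := (contMDiffAt_tot _ hx').1 hS'
  have hne : ((L.trivAt (S w).proj).1 (S w)).2 ≠ 0 := coord_ne_zero _ hx h0
  refine (h2'.mul (h2.inv₀ hne)).congr_of_eventuallyEq ?_
  filter_upwards [h, h2.continuousAt.eventually_ne hne,
    h1.continuousAt ((L.trivAt (S w).proj).1.open_baseSet.mem_nhds hx)] with y hy hy' hyb
  have := coord_eq_of_smulRel (L.trivAt (S w).proj) hyb hy
  change c y = ((L.trivAt (S w).proj).1 (S' y)).2 * (((L.trivAt (S w).proj).1 (S y)).2)⁻¹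
  rw [eq_mul_inv_iff_mul_eq₀ hy']
  exact this.symm

/-- A holomorphic nowhere vanishing section of `L` along `p : W → X`. -/
structure IsFrame (J : ModelWithCorners ℂ F K) (L : HolLineBundle I X) (p : W → X)
    (s : ∀ w, L.Fiber (p w)) : Prop where
  holo : ContMDiff J (I.prod 𝓘(ℂ, ℂ)) ω (fun w => (⟨p w, s w⟩ : L.Tot))
  ne_zero : ∀ w, s w ≠ 0

theorem IsFrame.comp {p : W → X} {s : ∀ w, L.Fiber (p w)} (hs : IsFrame J L p s) {g : Y → W}
    (hg : ContMDiff I' J ω g) : IsFrame I' L (fun y => p (g y)) (fun y => s (g y)) :=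
  ⟨hs.holo.comp hg, fun y => hs.ne_zero (g y)⟩

theorem IsFrame.smul {p : W → X} {s : ∀ w, L.Fiber (p w)} (hs : IsFrame J L p s) {c : W → ℂ}
    (hc : ContMDiff J 𝓘(ℂ, ℂ) ω c) (h0 : ∀ w, c w ≠ 0) :
    IsFrame J L p (fun w => c w • s w) :=
  ⟨fun w => contMDiffAt_smul (hc w) (hs.holo w), fun w => smul_ne_zero (h0 w) (hs.ne_zero w)⟩

theorem IsFrame.contMDiff_of_smulRel {p p' : W → X} {s : ∀ w, L.Fiber (p w)}
    {s' : ∀ w, L.Fiber (p' w)} (hs : IsFrame J L p s) (hs' : IsFrame J L p' s') {c : W → ℂ}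
    (h : ∀ w, L.SMulRel (s w) (s' w) (c w)) : ContMDiff J 𝓘(ℂ, ℂ) ω c := fun w =>
  contMDiffAt_of_smul_eq (hs.holo w) (hs'.holo w) (hs.ne_zero w) (Eventually.of_forall h)

/-- `p : W → X` has holomorphic local sections. -/
def HasLocalSections (J : ModelWithCorners ℂ F K) (I : ModelWithCorners ℂ E H) (p : W → X) : Prop :=
  ∀ x, ∃ σ : X → W, ContMDiffAt I J ω σ x ∧ ∀ᶠ y in 𝓝 x, p (σ y) = y

/-- A fibrewise linear map is holomorphic if it maps a holomorphic frame to a holomorphic frame. -/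
theorem IsFrame.contMDiff_map {p : W → X} (hp : HasLocalSections J I p) {s : ∀ w, L.Fiber (p w)}
    {s' : ∀ w, L'.Fiber (p w)} (hs : IsFrame J L p s) (hs' : IsFrame J L' p s')
    (φ : ∀ x, L.Fiber x →ₗ[ℂ] L'.Fiber x) (h : ∀ w, φ (p w) (s w) = s' w) :
    ContMDiff (I.prod 𝓘(ℂ, ℂ)) (I.prod 𝓘(ℂ, ℂ)) ω
      (fun v : L.Tot => (⟨v.proj, φ v.proj v.snd⟩ : L'.Tot)) := by
  intro v
  obtain ⟨σ, hσ, hσp⟩ := hp v.proj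
  have hproj : ContMDiffAt (I.prod 𝓘(ℂ, ℂ)) I ω (fun v : L.Tot => v.proj) v :=
    contMDiffAt_proj L.Fiber
  have hσ' : ContMDiffAt (I.prod 𝓘(ℂ, ℂ)) J ω (fun v : L.Tot => σ v.proj) v :=
    hσ.comp v hproj
  have hev : ∀ᶠ u : L.Tot in 𝓝 v, p (σ u.proj) = u.proj := hproj.continuousAt.eventually hσp
  -- The coordinate of `u` in the frame pulled back by the local section; the value `0` where `σ`
  -- fails to be a section is irrelevant near `v`.
  have hex : ∀ u : L.Tot, ∃ c, p (σ u.proj) = u.proj → L.SMulRel (s (σ u.proj)) u.2 c := by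
    intro u
    by_cases hu : p (σ u.proj) = u.proj
    · obtain ⟨c, hc⟩ := exists_smulRel hu.symm (hs.ne_zero _) u.2
      exact ⟨c, fun _ => hc⟩
    · exact ⟨0, fun h => absurd h hu⟩
  choose c hc using hex
  have hcs : ContMDiffAt (I.prod 𝓘(ℂ, ℂ)) 𝓘(ℂ, ℂ) ω c v :=
    contMDiffAt_of_smul_eq (S := fun u => ⟨_, s (σ u.proj)⟩) (S' := fun u => u)
      ((hs.holo _).comp v hσ') contMDiffAt_id (hs.ne_zero _) (hev.mono hc)
  refine (contMDiffAt_smul (S := fun u => ⟨_, s' (σ u.proj)⟩) hcs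
    ((hs'.holo _).comp v hσ')).congr_of_eventuallyEq ?_
  filter_upwards [hev] with u hu
  have h1 := hc u hu
  obtain ⟨x, u⟩ := u
  simp only at hu h1
  rw [← h]
  -- Generalising the frame vector removes its dependence on `σ x`, so that the base point `p (σ x)`
  -- can be rewritten to `x`.
  revert h1
  generalize s (σ x) = s₀
  revert s₀
  rw [hu]
  intro s₀ h1
  rw [smulRel_iff] at h1
  simp only [TotalSpace.mk_inj]
  rw [← map_smul]
  exact congrArg _ h1

end HolLineBundle

namespace HolLineBundle

open Filter

variable {E H : Type} [NormedAddCommGroup E] [NormedSpace ℂ E] [TopologicalSpace H]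
  {I : ModelWithCorners ℂ E H} {X : Type} [TopologicalSpace X] [ChartedSpace H X]
  {E' H' : Type} [NormedAddCommGroup E'] [NormedSpace ℂ E'] [TopologicalSpace H']
  {I' : ModelWithCorners ℂ E' H'} {Y : Type} [TopologicalSpace Y] [ChartedSpace H' Y]
  {F K : Type} [NormedAddCommGroup F] [NormedSpace ℂ F] [TopologicalSpace K]
  {J : ModelWithCorners ℂ F K} {W : Type} [TopologicalSpace W] [ChartedSpace K W]
  {L L' : HolLineBundle I X}

theorem exists_linearEquiv {x : X} {v : L.Fiber x} {v' : L'.Fiber x} (hv : v ≠ 0) (hv' : v' ≠ 0) :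
    ∃ φ : L.Fiber x ≃ₗ[ℂ] L'.Fiber x, φ v = v' := by
  have hx : x ∈ (L.trivAt x).1.baseSet := mem_baseSet_trivializationAt ℂ L.Fiber x
  have hx' : x ∈ (L'.trivAt x).1.baseSet := mem_baseSet_trivializationAt ℂ L'.Fiber x
  set e := (L.trivAt x).1.linearEquivAt ℂ x hx
  set e' := (L'.trivAt x).1.linearEquivAt ℂ x hx'
  have h : e v ≠ 0 := fun h => hv (e.map_eq_zero_iff.1 h)
  have h' : e' v' ≠ 0 := fun h => hv' (e'.map_eq_zero_iff.1 h)
  refine ⟨e ≪≫ₗ LinearEquiv.smulOfNeZero ℂ ℂ (e' v' / e v) (div_ne_zero h' h) ≪≫ₗ e'.symm, ?_⟩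
  change e'.symm ((e' v' / e v) * e v) = v'
  rw [div_mul_cancel₀ _ h, e'.symm_apply_apply]

/-- Two line bundles having frames along `p` with the same multipliers are isomorphic. -/
theorem IsFrame.exists_iso {p : W → X} (hp : HasLocalSections J I p) {s : ∀ w, L.Fiber (p w)}
    {s' : ∀ w, L'.Fiber (p w)} (hs : IsFrame J L p s) (hs' : IsFrame J L' p s')
    (h : ∀ w w' c, L.SMulRel (s w) (s w') c → L'.SMulRel (s' w) (s' w') c) :
    ∃ φ : Iso L L', ∀ w, φ.fiberEquiv (p w) (s w) = s' w := by
  have hsurj : ∀ x, ∃ w, p w = x := fun x => by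
    obtain ⟨σ, -, hσ⟩ := hp x
    exact ⟨_, hσ.self_of_nhds⟩
  -- The isomorphism over `x` is prescribed at one chosen point above `x`; equality of the factors
  -- makes it match the frames at all other points above `x`.
  have hex : ∀ x, ∃ φ : L.Fiber x ≃ₗ[ℂ] L'.Fiber x,
      ∃ w, ∃ hw : p w = x, φ (hw ▸ s w) = hw ▸ s' w := by
    intro x
    obtain ⟨w, rfl⟩ := hsurj x
    obtain ⟨φ, hφ⟩ := exists_linearEquiv (hs.ne_zero w) (hs'.ne_zero w)
    exact ⟨φ, w, rfl, hφ⟩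
  choose φ W₀ hW₀ hφ using hex
  have key : ∀ w, φ (p w) (s w) = s' w := by
    intro w
    obtain ⟨c, hc⟩ := exists_smulRel (hW₀ (p w)).symm (hs.ne_zero (W₀ (p w))) (s w)
    have h1 := h _ _ _ hc
    have h2 := hφ (p w)
    revert h1 h2 hc
    generalize s (W₀ (p w)) = a
    generalize s' (W₀ (p w)) = b
    generalize hW₀ (p w) = e
    revert a b e
    generalize p (W₀ (p w)) = y
    rintro a b rfl h1 h2 h3
    rw [smulRel_iff] at h1 h2
    simp only at h3
    rw [h1, h2, map_smul, h3]
  refine ⟨⟨φ, ?_, ?_⟩, key⟩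
  · exact hs.contMDiff_map hp hs' (fun x => (φ x).toLinearMap) key
  · exact hs'.contMDiff_map hp hs (fun x => (φ x).symm.toLinearMap) fun w => by
      change (φ (p w)).symm (s' w) = s w
      rw [← key, LinearEquiv.symm_apply_apply]

/-- The image of a frame under an isomorphism. -/
theorem IsFrame.iso_symm (φ : Iso L L') {p : W → X} {s' : ∀ w, L'.Fiber (p w)}
    (hs' : IsFrame J L' p s') : IsFrame J L p (fun w => (φ.fiberEquiv (p w)).symm (s' w)) :=
  ⟨φ.holo_symm.comp hs'.holo, fun w =>
    (φ.fiberEquiv (p w)).symm.map_ne_zero_iff.2 (hs'.ne_zero w)⟩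

theorem SMulRel.iso_symm (φ : Iso L L') {x x' : X} {v : L'.Fiber x} {v' : L'.Fiber x'} {c : ℂ}
    (h : L'.SMulRel v v' c) :
    L.SMulRel ((φ.fiberEquiv x).symm v) ((φ.fiberEquiv x').symm v') c := by
  obtain rfl := h.proj_eq
  rw [smulRel_iff] at *
  rw [h, map_smul]

theorem hasLocalSections_id : HasLocalSections I I (fun x : X => x) := fun _ =>
  ⟨fun x => x, contMDiffAt_id, Eventually.of_forall fun _ => rfl⟩

theorem isFrame_trivial {p : W → X} (hp : ContMDiff J I ω p) :
    IsFrame J (trivial I X) p (fun _ => (1 : ℂ)) := by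
  refine ⟨fun w => (contMDiffAt_totalSpace (F := ℂ) (E := Bundle.Trivial X ℂ)).2
    ⟨hp w, contMDiffAt_const (c := (1 : ℂ))⟩, fun w => ?_⟩
  exact one_ne_zero (α := ℂ)

theorem smulRel_trivial {x x' : X} (h : x' = x) :
    (trivial I X).SMulRel (x := x) (x' := x') (1 : ℂ) (1 : ℂ) 1 := by
  subst h
  exact smulRel_iff.2 (one_smul ℂ _).symm

/-! ### Pullback -/

theorem contMDiff_pullback_iff {f : C^ω⟮I', Y; I, X⟯} {q : W → Y} {s : ∀ w, L.Fiber (f (q w))} :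
    ContMDiff J (I'.prod 𝓘(ℂ, ℂ)) ω (fun w => (⟨q w, s w⟩ : (L.pullback f).Tot)) ↔
      ContMDiff J I' ω q ∧
        ContMDiff J (I.prod 𝓘(ℂ, ℂ)) ω (fun w => (⟨f (q w), s w⟩ : L.Tot)) := by
  have h : ∀ w, ContMDiffAt J (I'.prod 𝓘(ℂ, ℂ)) ω (fun w => (⟨q w, s w⟩ : (L.pullback f).Tot)) w ↔
      ContMDiffAt J I' ω q w ∧
        ContMDiffAt J (I.prod 𝓘(ℂ, ℂ)) ω (fun w => (⟨f (q w), s w⟩ : L.Tot)) w := by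
    intro w
    rw [contMDiffAt_totalSpace, contMDiffAt_totalSpace]
    constructor
    · rintro ⟨h1, h2⟩
      exact ⟨h1, (f.contMDiff _).comp w h1, h2⟩
    · rintro ⟨h1, -, h2⟩
      exact ⟨h1, h2⟩
  exact ⟨fun hh => ⟨fun w => ((h w).1 (hh w)).1, fun w => ((h w).1 (hh w)).2⟩,
    fun hh w => (h w).2 ⟨hh.1 w, hh.2 w⟩⟩

theorem IsFrame.pullback {f : C^ω⟮I', Y; I, X⟯} {q : W → Y} (hq : ContMDiff J I' ω q)
    {s : ∀ w, L.Fiber (f (q w))} (hs : IsFrame J L (fun w => f (q w)) s) :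
    IsFrame J (L.pullback f) q s :=
  ⟨contMDiff_pullback_iff.2 ⟨hq, hs.holo⟩, hs.ne_zero⟩

theorem IsFrame.of_pullback {f : C^ω⟮I', Y; I, X⟯} {q : W → Y}
    {s : ∀ w, L.Fiber (f (q w))} (hs : IsFrame J (L.pullback f) q s) :
    IsFrame J L (fun w => f (q w)) s :=
  ⟨(contMDiff_pullback_iff.1 hs.holo).2, hs.ne_zero⟩

theorem SMulRel.pullback {f : C^ω⟮I', Y; I, X⟯} {y y' : Y} (hy : y' = y) {v : L.Fiber (f y)}
    {v' : L.Fiber (f y')} {c : ℂ} (h : L.SMulRel v v' c) : (L.pullback f).SMulRel v v' c := by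
  subst hy
  exact smulRel_iff (L := L.pullback f).2 (smulRel_iff.1 h)

theorem SMulRel.of_pullback {f : C^ω⟮I', Y; I, X⟯} {y y' : Y} {v : L.Fiber (f y)}
    {v' : L.Fiber (f y')} {c : ℂ} (h : (L.pullback f).SMulRel v v' c) : L.SMulRel v v' c := by
  obtain rfl : y' = y := h.proj_eq
  exact smulRel_iff.2 (smulRel_iff (L := L.pullback f).1 h)

/-! ### Tensor product and dual -/

theorem contMDiffAt_toLineBundle {N : X → Type} [∀ x, AddCommGroup (N x)] [∀ x, Module ℂ (N x)]
    (A : LocalFrames I N) {p : W → X} {s : ∀ w, N (p w)} {w : W} (hp : ContMDiffAt J I ω p w)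
    (hs : ContMDiffAt J 𝓘(ℂ, ℂ) ω (fun y => A.coord (A.idx (p w)) (p y) (s y)) w) :
    ContMDiffAt J (I.prod 𝓘(ℂ, ℂ)) ω (fun w => (⟨p w, s w⟩ : A.toLineBundle.Tot)) w :=
  contMDiffAt_totalSpace.2 ⟨hp, hs⟩

theorem IsFrame.proj {p : W → X} {s : ∀ w, L.Fiber (p w)} (hs : IsFrame J L p s) :
    ContMDiff J I ω p :=
  (contMDiff_proj L.Fiber).comp hs.holo

theorem IsFrame.coord {p : W → X} {s : ∀ w, L.Fiber (p w)} (hs : IsFrame J L p s) (e : L.Triv)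
    {w : W} (hw : p w ∈ e.1.baseSet) :
    ContMDiffAt J 𝓘(ℂ, ℂ) ω (fun y => (e.1 ⟨p y, s y⟩).2) w :=
  ((contMDiffAt_tot (S := fun w => (⟨p w, s w⟩ : L.Tot)) e hw).1 (hs.holo w)).2

theorem IsFrame.eventually_mem {p : W → X} {s : ∀ w, L.Fiber (p w)} (hs : IsFrame J L p s)
    (e : L.Triv) {w : W} (hw : p w ∈ e.1.baseSet) : ∀ᶠ y in 𝓝 w, p y ∈ e.1.baseSet :=
  hs.proj.continuous.continuousAt (e.1.open_baseSet.mem_nhds hw)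

theorem IsFrame.tensor {p : W → X} {s : ∀ w, L.Fiber (p w)} {s' : ∀ w, L'.Fiber (p w)}
    (hs : IsFrame J L p s) (hs' : IsFrame J L' p s') :
    IsFrame J (L.tensor L') p (fun w => s w ⊗ₜ[ℂ] s' w) := by
  have hb : ∀ w, p w ∈ (L.trivAt (p w)).1.baseSet := fun w =>
    mem_baseSet_trivializationAt ℂ L.Fiber _
  have hb' : ∀ w, p w ∈ (L'.trivAt (p w)).1.baseSet := fun w =>
    mem_baseSet_trivializationAt ℂ L'.Fiber _
  have key : ∀ w y, p y ∈ (L.trivAt (p w)).1.baseSet → p y ∈ (L'.trivAt (p w)).1.baseSet →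
      (tensorFrames L L').coord ((tensorFrames L L').idx (p w)) (p y) (s y ⊗ₜ[ℂ] s' y) =
        ((L.trivAt (p w)).1 ⟨p y, s y⟩).2 * ((L'.trivAt (p w)).1 ⟨p y, s' y⟩).2 := by
    intro w y h h'
    change (LinearMap.mul' ℂ ℂ ∘ₗ TensorProduct.map ((L.trivAt (p w)).1.linearMapAt ℂ (p y))
      ((L'.trivAt (p w)).1.linearMapAt ℂ (p y))) _ = _
    rw [LinearMap.comp_apply, TensorProduct.map_tmul, LinearMap.mul'_apply,
      Trivialization.coe_linearMapAt_of_mem _ h, Trivialization.coe_linearMapAt_of_mem _ h']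
  refine ⟨fun w => contMDiffAt_toLineBundle (tensorFrames L L') (s := fun w => s w ⊗ₜ[ℂ] s' w)
    (hs.proj w) (((hs.coord _ (hb w)).mul (hs'.coord _ (hb' w))).congr_of_eventuallyEq ?_), fun w h => ?_⟩
  · filter_upwards [hs.eventually_mem _ (hb w), hs'.eventually_mem _ (hb' w)] with y h h'
    exact key w y h h'
  · have h1 := key w w (hb w) (hb' w)
    have h2 := mul_ne_zero (coord_ne_zero _ (hb w) (hs.ne_zero w))
      (coord_ne_zero _ (hb' w) (hs'.ne_zero w))
    rw [← h1] at h2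
    refine h2 ?_
    have h3 : s w ⊗ₜ[ℂ] s' w = 0 := h
    rw [h3, map_zero]

theorem SMulRel.tensor {x x' : X} {v : L.Fiber x} {v' : L.Fiber x'} {u : L'.Fiber x}
    {u' : L'.Fiber x'} {c d : ℂ} (h : L.SMulRel v v' c) (h' : L'.SMulRel u u' d) :
    (L.tensor L').SMulRel (v ⊗ₜ[ℂ] u) (v' ⊗ₜ[ℂ] u') (c * d) := by
  obtain rfl := h.proj_eq
  rw [smulRel_iff] at h h'
  subst h h'
  refine smulRel_iff.2 ?_
  exact (TensorProduct.smul_tmul_smul c d v u)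

/-- The functional with value `1` at `v`. -/
def dualVector {x : X} (v : L.Fiber x) : Module.Dual ℂ (L.Fiber x) :=
  ((L.trivAt x).1 ⟨x, v⟩).2⁻¹ • (L.trivAt x).1.linearMapAt ℂ x

theorem dualVector_smul {x : X} {v : L.Fiber x} (hv : v ≠ 0) (c : ℂ) :
    dualVector (L := L) v (c • v) = c := by
  have hx : x ∈ (L.trivAt x).1.baseSet := mem_baseSet_trivializationAt ℂ L.Fiber x
  rw [dualVector, LinearMap.smul_apply, map_smul, Trivialization.coe_linearMapAt_of_mem _ hx,
    smul_eq_mul, smul_eq_mul, mul_left_comm, inv_mul_cancel₀ (coord_ne_zero _ hx hv), mul_one]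

theorem IsFrame.dual {p : W → X} {s : ∀ w, L.Fiber (p w)} (hs : IsFrame J L p s) :
    IsFrame J L.dual p (fun w => dualVector (L := L) (s w)) := by
  have hb : ∀ w, p w ∈ (L.trivAt (p w)).1.baseSet := fun w =>
    mem_baseSet_trivializationAt ℂ L.Fiber _
  refine ⟨fun w => contMDiffAt_toLineBundle (dualFrames L) (s := fun w => dualVector (L := L) (s w))
    (hs.proj w) (((hs.coord _ (hb w)).inv₀ (coord_ne_zero _ (hb w)
      (hs.ne_zero w))).congr_of_eventuallyEq ?_), fun w h => ?_⟩
  · filter_upwards [hs.eventually_mem _ (hb w)] with y hy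
    change dualVector (L := L) (s y) ((L.trivAt (p w)).1.symmₗ ℂ (p y) 1) = _
    have h1 : (L.trivAt (p w)).1.symmₗ ℂ (p y) 1 =
        ((L.trivAt (p w)).1 ⟨p y, s y⟩).2⁻¹ • s y := by
      have h2 := L.smul_symm_one (L.trivAt (p w)) hy (s y)
      rw [Trivialization.coe_linearMapAt_of_mem _ hy] at h2
      rw [eq_inv_smul_iff₀ (coord_ne_zero _ hy (hs.ne_zero y))]
      exact h2
    rw [h1, dualVector_smul (hs.ne_zero y)]
  · have h1 := dualVector_smul (hs.ne_zero w) 1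
    have h2 : dualVector (L := L) (s w) = 0 := h
    rw [h2, LinearMap.zero_apply] at h1
    exact zero_ne_one h1

theorem SMulRel.dual {x x' : X} {v : L.Fiber x} {v' : L.Fiber x'} {c : ℂ}
    (h : L.SMulRel v v' c) (hv : v ≠ 0) (hv' : v' ≠ 0) :
    L.dual.SMulRel (dualVector (L := L) v) (dualVector (L := L) v') c⁻¹ := by
  obtain rfl := h.proj_eq
  rw [smulRel_iff] at h
  refine smulRel_iff.2 ?_
  change (dualVector v' : Module.Dual ℂ (L.Fiber x')) = c⁻¹ • dualVector v
  ext u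
  obtain ⟨d, hd⟩ := exists_smulRel rfl hv' u
  rw [smulRel_iff] at hd
  have hc : c ≠ 0 := by
    rintro rfl
    exact hv' (by rw [h, zero_smul])
  rw [hd, dualVector_smul hv', LinearMap.smul_apply, h, smul_smul, dualVector_smul hv,
    smul_eq_mul, mul_comm d, inv_mul_cancel_left₀ hc]

/-! ### Multipliers of a frame -/

/-- The trivialization sends `s` to `1`. As `φ_{w + a}` sends `s (w + a)` to `1`, it sends `s w = e
• s (w + a)` to `e`; so multipliers are the inverses of the factors by which the frame grows. -/
theorem IsFrame.hasMultipliers {κ : Type} [Add W] {p : C^ω⟮J, W; I, X⟯} {a : κ → W}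
    {e : κ → W → ℂ} {s : ∀ w, L.Fiber (p w)} (hs : IsFrame J L p s)
    (h : ∀ k w, L.SMulRel (s (w + a k)) (s w) (e k w)) : L.HasMultipliers p a e := by
  refine ⟨fun k w => (h k w).proj_eq.symm, ?_⟩
  have hs' : IsFrame J (L.pullback p) (fun w : W => w) s := IsFrame.pullback contMDiff_id hs
  obtain ⟨φ, hφ⟩ := hs'.exists_iso hasLocalSections_id
    (isFrame_trivial (I := J) (X := W) contMDiff_id) (by
      intro w w' c hc
      obtain rfl : w' = w := hc.proj_eq
      have h1 : c = 1 := hc.unique (smulRel_iff (L := L.pullback p).2 (one_smul ℂ _).symm)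
        (hs.ne_zero w')
      rw [h1]
      exact smulRel_trivial rfl)
  refine ⟨φ, fun k w v v' hv => ?_⟩
  obtain ⟨c, hc⟩ := exists_smulRel rfl (hs.ne_zero w) v
  have h1 := (h k w).trans hc
  have h2 : L.SMulRel (s (w + a k)) v' (c * e k w) := by
    rw [SMulRel] at h1 ⊢
    rw [hv, h1]
  rw [smulRel_iff] at h2 hc
  have hφ' : ∀ w (d : ℂ), (show ℂ from φ.fiberEquiv w (d • s w)) = d := by
    intro w d
    have h3 := (φ.fiberEquiv w).map_smul d (s w)
    refine h3.trans ?_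
    rw [hφ w]
    exact mul_one d
  rw [h2, hc, hφ', hφ', mul_comm]

end HolLineBundle

/-! ### Frames of line bundles on tori defined by multipliers -/

namespace Torus

open HolLineBundle

variable {E : Type} [NormedAddCommGroup E] [NormedSpace ℂ E] (Λ : AddSubgroup E)
  [DiscreteTopology Λ]

theorem hasLocalSections_mk :
    HasLocalSections 𝓘(ℂ, E) 𝓘(ℂ, E) (QuotientAddGroup.mk : E → E ⧸ Λ) := fun x =>
  ⟨chartAt E x, contMDiffOn_chart.contMDiffAt
    ((chartAt E x).open_source.mem_nhds (mem_chart_source E x)), by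
    filter_upwards [(chartAt E x).open_source.mem_nhds (mem_chart_source E x)] with y hy
    exact mk_chart Λ (chart_mem_atlas E x) hy⟩

variable {Λ}

/-- Line bundles over a torus which have the same multipliers are isomorphic. -/
theorem nonempty_iso {L L' : HolLineBundle 𝓘(ℂ, E) (E ⧸ Λ)} {s : ∀ v : E, L.Fiber (v : E ⧸ Λ)}
    {s' : ∀ v : E, L'.Fiber (v : E ⧸ Λ)} (hs : IsFrame 𝓘(ℂ, E) L (QuotientAddGroup.mk : E → E ⧸ Λ) s)
    (hs' : IsFrame 𝓘(ℂ, E) L' (QuotientAddGroup.mk : E → E ⧸ Λ) s') (g : E → E → ℂ)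
    (h : ∀ l ∈ Λ, ∀ v, L.SMulRel (s v) (s (v + l)) (g l v))
    (h' : ∀ l ∈ Λ, ∀ v, L'.SMulRel (s' v) (s' (v + l)) (g l v)) : Nonempty (Iso L L') := by
  obtain ⟨φ, -⟩ := hs.exists_iso (hasLocalSections_mk Λ) hs' (by
    intro w w' c hc
    have hl : w' - w ∈ Λ := by
      have h1 := hc.proj_eq.symm
      rw [QuotientAddGroup.eq] at h1
      rwa [sub_eq_neg_add]
    have h1 := h _ hl w
    have h2 := h' _ hl w
    rw [add_sub_cancel] at h1 h2
    rwa [hc.unique h1 (hs.ne_zero w)])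
  exact ⟨φ⟩

namespace Multipliers

variable (m : Multipliers Λ)

/-- The element of the fibre over the class of `v` with value `1` at `v`. -/
def unitAt (v : E) : m.lineBundle.Fiber (v : E ⧸ Λ) := m.unit ⟨v, rfl⟩

/-- Elements of the fibre satisfy `θ (v + l) = e_l v * θ v`, so the one with value `1` at `v + l`
has value `(e_l v)⁻¹` at `v`. -/
theorem smulRel_unitAt (l : E) (hl : l ∈ Λ) (v : E) :
    m.lineBundle.SMulRel (m.unitAt v) (m.unitAt (v + l)) (m.e ⟨l, hl⟩ v)⁻¹ := by
  suffices h : ∀ (x' : E ⧸ Λ) (h1 : (v : E ⧸ Λ) = x')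
      (h2 : ((v + l : E) : E ⧸ Λ) = x'), (m.unit ⟨v + l, h2⟩ : m.fiber x') =
        (m.e ⟨l, hl⟩ v)⁻¹ • m.unit ⟨v, h1⟩ by
    have hx : ((v + l : E) : E ⧸ Λ) = (v : E ⧸ Λ) := by
      rw [eq_comm, QuotientAddGroup.eq]
      simpa using hl
    have h3 := h _ rfl hx
    have h4 : (⟨((v + l : E) : E ⧸ Λ), m.unitAt (v + l)⟩ : m.lineBundle.Tot) =
        ⟨(v : E ⧸ Λ), m.unit ⟨v + l, hx⟩⟩ := by
      unfold unitAt
      have : ∀ (x' : E ⧸ Λ) (e : ((v + l : E) : E ⧸ Λ) = x'),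
          (⟨((v + l : E) : E ⧸ Λ), m.unit ⟨v + l, rfl⟩⟩ : m.lineBundle.Tot) =
            ⟨x', m.unit ⟨v + l, e⟩⟩ := by
        rintro x' rfl
        rfl
      exact this _ hx
    rw [SMulRel, h4, h3]
    rfl
  intro x' h1 h2
  have h3 := m.apply_smul_unit ⟨v, h1⟩ (m.unit ⟨v + l, h2⟩)
  have h4 := (m.unit ⟨v + l, h2⟩).2 ⟨l, hl⟩ ⟨v, h1⟩ ⟨v + l, h2⟩ rfl
  rw [m.unit_apply_self] at h4
  rw [← h3, eq_inv_of_mul_eq_one_right h4.symm]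

/-- Near `v` the chart sends the class of `w` to `w + l` with a fixed `l ∈ Λ`, and the coordinate of
`unitAt w` there is the holomorphic function `e_l w`. -/
theorem isFrame_unitAt :
    IsFrame 𝓘(ℂ, E) m.lineBundle (QuotientAddGroup.mk : E → E ⧸ Λ) m.unitAt := by
  refine ⟨fun v => contMDiffAt_toLineBundle m.frames (s := fun v => m.unitAt v)
    (contMDiff_mk Λ v) ?_, fun v h => ?_⟩
  · have hb : ((v : E) : E ⧸ Λ) ∈ (chartAt E (v : E ⧸ Λ)).source := mem_chart_source E _
    have hev := chart_mk_eventually Λ (chart_mem_atlas E (v : E ⧸ Λ)) hb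
    have hl : chartAt E (v : E ⧸ Λ) (v : E ⧸ Λ) - v ∈ Λ := by
      have := mk_chart Λ (chart_mem_atlas E (v : E ⧸ Λ)) hb
      rw [eq_comm, QuotientAddGroup.eq] at this
      rwa [sub_eq_neg_add]
    refine ((m.holo ⟨_, hl⟩).contMDiff.contMDiffAt).congr_of_eventuallyEq ?_
    filter_upwards [hev, (contMDiff_mk Λ).continuous.continuousAt
      ((chartAt E (v : E ⧸ Λ)).open_source.mem_nhds hb)] with w hw hwb
    change m.e ⟨(pt (v : E ⧸ Λ) (w : E ⧸ Λ)).1 - w, _⟩ w = m.e ⟨_, hl⟩ w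
    refine congrFun (congrArg m.e (Subtype.ext ?_)) w
    change (pt (v : E ⧸ Λ) (w : E ⧸ Λ)).1 - w = _
    rw [pt_coe hwb, hw, add_sub_cancel_left]
  · have h1 := m.unit_apply_self (⟨v, rfl⟩ : {w : E // (w : E ⧸ Λ) = (v : E ⧸ Λ)})
    have h2 : m.unit (⟨v, rfl⟩ : {w : E // (w : E ⧸ Λ) = (v : E ⧸ Λ)}) = 0 := h
    rw [h2] at h1
    exact zero_ne_one h1

end Multipliers

end Torus

/-! ### From frames on slices to frames on `ℂ × ℂ` -/

namespace HolLineBundle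

open Filter

variable {E H : Type} [NormedAddCommGroup E] [NormedSpace ℂ E] [TopologicalSpace H]
  {I : ModelWithCorners ℂ E H} {X : Type} [TopologicalSpace X] [ChartedSpace H X]
  {L : HolLineBundle I X}

theorem contMDiffAt_prod_iff_contDiffAt {f : ℂ × ℂ → ℂ} {p : ℂ × ℂ} :
    ContMDiffAt (𝓘(ℂ, ℂ).prod 𝓘(ℂ, ℂ)) 𝓘(ℂ, ℂ) ω f p ↔ ContDiffAt ℂ ω f p := by
  rw [← contMDiffAt_iff_contDiffAt, modelWithCornersSelf_prod, ← chartedSpaceSelf_prod]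

theorem coord_eq_transition (e e' : L.Triv) {x : X} (he : x ∈ e.1.baseSet) (he' : x ∈ e'.1.baseSet)
    (v : L.Fiber x) :
    (e'.1 ⟨x, v⟩).2 = e'.1.linearMapAt ℂ x (e.1.symmₗ ℂ x 1) * (e.1 ⟨x, v⟩).2 := by
  have h := L.smul_symm_one e he v
  rw [Trivialization.coe_linearMapAt_of_mem _ he] at h
  conv_lhs => rw [← h]
  rw [coord_smul _ he', Trivialization.coe_linearMapAt_of_mem _ he', mul_comm]

/-- A nowhere vanishing section of a line bundle along a map `Φ : ℂ × ℂ → X`, which is holomorphic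
on the slices `ℂ × {μ}` and on `{0} × ℂ`, and quasi-periodic on the slices, is holomorphic. -/
theorem isFrame_of_slices {Λ : AddSubgroup ℂ} (hΛ : IsCobounded Λ) {Φ : ℂ × ℂ → X}
    (hΦ : ContMDiff (𝓘(ℂ, ℂ).prod 𝓘(ℂ, ℂ)) I ω Φ) {s : ∀ w, L.Fiber (Φ w)}
    (hslice : ∀ μ, IsFrame 𝓘(ℂ, ℂ) L (fun z => Φ (z, μ)) (fun z => s (z, μ)))
    (hbase : IsFrame 𝓘(ℂ, ℂ) L (fun μ => Φ (0, μ)) (fun μ => s (0, μ)))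
    {χ : ℂ → ℂ → ℂ} (hχ : ∀ l ∈ Λ, ContDiff ℂ ω (χ l))
    (hper : ∀ l ∈ Λ, ∀ z μ, L.SMulRel (s (z, μ)) (s (z + l, μ)) (χ l μ)) :
    IsFrame (𝓘(ℂ, ℂ).prod 𝓘(ℂ, ℂ)) L Φ s := by
  have hne : ∀ w, s w ≠ 0 := fun w => (hslice w.2).ne_zero w.1
  have hopen : ∀ e : L.Triv, IsOpen (Φ ⁻¹' e.1.baseSet) := fun e =>
    e.1.open_baseSet.preimage hΦ.continuous
  have hf : IsSliceFamily Λ (fun e : L.Triv => Φ ⁻¹' e.1.baseSet)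
      (fun e p => (e.1 ⟨Φ p, s p⟩).2) :=
    { cobounded := hΛ
      isOpen := hopen
      cover := fun p => ⟨L.trivAt (Φ p), mem_baseSet_trivializationAt ℂ L.Fiber _⟩
      ne_zero := fun e p hp => coord_ne_zero e hp (hne p)
      slice := fun e p hp => by
        have h := ((hslice p.2).coord e (w := p.1) hp).contDiffAt
        exact h.differentiableAt (by simp)
      base := fun e μ hμ => by
        have h := (hbase.coord e (w := μ) hμ).contDiffAt
        exact h.differentiableAt (by simp)
      -- Since `Φ (z + l, μ) = Φ (z, μ)`, the ratio of coordinates is `χ l μ` times a transition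
      -- function of `L` along `Φ`, both holomorphic in the pair.
      ratio := fun e e' l hl p hp hp' => by
        have hpe : Φ p ∈ e'.1.baseSet := by
          have := (hper l hl p.1 p.2).proj_eq
          change Φ (p.1 + l, p.2) ∈ e'.1.baseSet at hp'
          rwa [this] at hp'
        have htr : ContMDiffAt (𝓘(ℂ, ℂ).prod 𝓘(ℂ, ℂ)) 𝓘(ℂ, ℂ) ω
            (fun q => e'.1.linearMapAt ℂ (Φ q) (e.1.symmₗ ℂ (Φ q) 1)) p :=
          ((L.holo_transition e e').contMDiffAt ((e.1.open_baseSet.inter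
            e'.1.open_baseSet).mem_nhds ⟨hp, hpe⟩)).comp p (hΦ p)
        have h1 := contMDiffAt_prod_iff_contDiffAt.1 htr
        have h2 : ContDiffAt ℂ ω (fun q : ℂ × ℂ => χ l q.2) p :=
          ((hχ l hl).comp contDiff_snd).contDiffAt
        refine ((h2.mul h1).congr_of_eventuallyEq ?_).of_le le_top
        filter_upwards [(hopen e).mem_nhds hp, (hopen e').mem_nhds hpe] with q hq hq'
        rw [coord_eq_of_smulRel e' hq' (hper l hl q.1 q.2), coord_eq_transition e e' hq hq',
          ← mul_assoc, mul_div_assoc, div_self (coord_ne_zero e hq (hne q)), mul_one] }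
  refine ⟨fun w => ?_, hne⟩
  have hw : Φ w ∈ (L.trivAt (Φ w)).1.baseSet := mem_baseSet_trivializationAt ℂ L.Fiber _
  exact contMDiffAt_totalSpace.2 ⟨hΦ w, contMDiffAt_prod_iff_contDiffAt.2
    (hf.analyticAt (a := L.trivAt (Φ w)) hw).contDiffAt⟩

end HolLineBundle

/-! ### The lattice, the frames on `M` and the classifying map -/

namespace EllipticCurve

open HolLineBundle
open Complex (I exp)

variable (δ : ℕ+) (τ : UpperHalfPlane)

theorem isCobounded_lattice : IsCobounded (lattice δ τ) := by
  have hδ : (0 : ℝ) < (δ : ℕ) := by exact_mod_cast δ.pos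
  have hτ := τ.im_pos
  refine ⟨(δ : ℕ) + τ.im, fun z => ?_⟩
  -- The imaginary part is reduced first, by a multiple of `τ`; the subsequent reduction of the real
  -- part by a multiple of `δ` does not disturb it.
  set b : ℤ := ⌊z.im / τ.im⌋
  set a : ℤ := ⌊(z - b * (τ : ℂ)).re / (δ : ℕ)⌋
  refine ⟨((-a : ℤ) : ℂ) * (δ : ℂ) + ((-b : ℤ) : ℂ) * (τ : ℂ), (mem_lattice δ τ).2 ⟨_, _, rfl⟩, ?_⟩
  have him : (z + (((-a : ℤ) : ℂ) * (δ : ℂ) + ((-b : ℤ) : ℂ) * (τ : ℂ))).im =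
      τ.im * Int.fract (z.im / τ.im) := by
    rw [Int.fract, mul_sub, mul_div_cancel₀ _ hτ.ne']
    simp [b]
    ring
  have hre : (z + (((-a : ℤ) : ℂ) * (δ : ℂ) + ((-b : ℤ) : ℂ) * (τ : ℂ))).re =
      (δ : ℕ) * Int.fract ((z - b * (τ : ℂ)).re / (δ : ℕ)) := by
    rw [Int.fract, mul_sub, mul_div_cancel₀ _ hδ.ne']
    simp [a]
    ring
  refine (Complex.norm_le_abs_re_add_abs_im _).trans ?_
  rw [him, hre, abs_mul, abs_mul, abs_of_pos hδ, abs_of_pos hτ, Int.abs_fract, Int.abs_fract]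
  exact add_le_add (mul_le_of_le_one_right hδ.le (Int.fract_lt_one _).le)
    (mul_le_of_le_one_right hτ.le (Int.fract_lt_one _).le)

/-- The coordinate `n` of `l = m λ₁ + n λ₂`. -/
def tauCoord (l : ℂ) : ℂ := ((l.im / τ.im : ℝ) : ℂ)

theorem tauCoord_delta : tauCoord τ (δ : ℂ) = 0 := by simp [tauCoord]

theorem tauCoord_tau : tauCoord τ (τ : ℂ) = 1 := by
  have hτ : τ.im ≠ 0 := τ.im_pos.ne'
  simp [tauCoord, hτ]

theorem two_im_eq (l : ℂ) : l - conj l = 2 * I * τ.im * tauCoord τ l := by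
  have hτ : (τ.im : ℂ) ≠ 0 := Complex.ofReal_ne_zero.2 τ.im_pos.ne'
  rw [Complex.sub_conj, tauCoord]
  push_cast
  field_simp

theorem coe_im_ne_zero : (τ.im : ℂ) ≠ 0 := Complex.ofReal_ne_zero.2 τ.im_pos.ne'

/-! ### Frames of the line bundles on `M` -/

theorem smulRel_L0 {l : ℂ} (hl : l ∈ lattice δ τ) (z : ℂ) :
    (L0 δ τ).SMulRel ((multipliersL0 δ τ).unitAt z) ((multipliersL0 δ τ).unitAt (z + l))
      (exp (2 * Real.pi * I * tauCoord τ l * z + Real.pi * I * tauCoord τ l ^ 2 * τ)) := by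
  have h := (multipliersL0 δ τ).smulRel_unitAt l hl z
  have he : ((multipliersL0 δ τ).e ⟨l, hl⟩ z)⁻¹ =
      exp (2 * Real.pi * I * tauCoord τ l * z + Real.pi * I * tauCoord τ l ^ 2 * τ) := by
    change (exp (-2 * Real.pi * I * tauCoord τ l * z
      - Real.pi * I * tauCoord τ l ^ 2 * τ))⁻¹ = _
    rw [← Complex.exp_neg]
    congr 1
    ring
  rw [he] at h
  exact h

/-- A frame of `P_α`, for `α = μ e₁^* + β` with `β ∈ Λ̄^*`, with multipliers
`exp (-2πi n μ)`. -/
def flatFrame (α : ConjDual) (μ z : ℂ) : (degreeZeroBundle δ τ α).Fiber (z : M δ τ) :=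
  exp (Real.pi * μ / τ.im * z -
      2 * Real.pi * I * conj ((α - ContinuousLinearMap.toSpanSingleton ℂ (e1star τ) μ) 1) * z) •
    (flatMultipliers δ τ α).unitAt z

theorem isFrame_flatFrame (α : ConjDual) (μ : ℂ) :
    IsFrame 𝓘(ℂ, ℂ) (degreeZeroBundle δ τ α) (QuotientAddGroup.mk : ℂ → M δ τ)
      (flatFrame δ τ α μ) := by
  refine (flatMultipliers δ τ α).isFrame_unitAt.smul (ContDiff.contMDiff ?_)
    fun z => Complex.exp_ne_zero _
  exact ContDiff.cexp (by fun_prop)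

/-- The unit frame has the factor `exp(-2πi α(l))`. The exponential with `πμz / Im τ` completes the
contribution of `μ e₁^*` to `exp(πμ (l - conj l) / Im τ) = exp(2πi n μ)`; the one with `conj (β 1)`
completes that of `β` to `exp(-2πi · 2 Re β(l)) = 1`. -/
theorem smulRel_flatFrame {α : ConjDual} {μ : ℂ}
    (hα : α - ContinuousLinearMap.toSpanSingleton ℂ (e1star τ) μ ∈ dualLattice δ τ) {l : ℂ}
    (hl : l ∈ lattice δ τ) (z : ℂ) :
    (degreeZeroBundle δ τ α).SMulRel (flatFrame δ τ α μ z) (flatFrame δ τ α μ (z + l))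
      (exp (2 * Real.pi * I * tauCoord τ l * μ)) := by
  obtain ⟨n, hn⟩ := hα l hl
  set β := α - ContinuousLinearMap.toSpanSingleton ℂ (e1star τ) μ with hβ
  have hαl : α l = μ * (-I / (2 * τ.im) * conj l) + β l := by
    have : α l = (ContinuousLinearMap.toSpanSingleton ℂ (e1star τ) μ) l + β l := by
      rw [hβ]; simp
    exact this
  have hβl : conj (β 1) * l = conj (β l) := by
    rw [conjDual_apply β l]; simp
  have hre : β l + conj (β l) = n := by
    rw [Complex.add_conj, hn]; push_cast; ring
  have h := (flatMultipliers δ τ α).smulRel_unitAt l hl z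
  set k : ℂ → ℂ := fun z => Real.pi * μ / τ.im * z - 2 * Real.pi * I * conj (β 1) * z with hk
  have h1 : (degreeZeroBundle δ τ α).SMulRel ((flatMultipliers δ τ α).unitAt z)
      (flatFrame δ τ α μ (z + l)) (exp (k (z + l)) * ((flatMultipliers δ τ α).e ⟨l, hl⟩ z)⁻¹) :=
    h.trans (smulRel_smul _ _)
  have h2 : (degreeZeroBundle δ τ α).SMulRel ((flatMultipliers δ τ α).unitAt z)
      (flatFrame δ τ α μ z) (exp (k z)) := smulRel_smul _ _
  have h3 := (h2.symm (Complex.exp_ne_zero _)).trans h1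
  have he : exp (k (z + l)) * ((flatMultipliers δ τ α).e ⟨l, hl⟩ z)⁻¹ * (exp (k z))⁻¹ =
      exp (2 * Real.pi * I * tauCoord τ l * μ) := by
    change exp (k (z + l)) * (exp (2 * Real.pi * I * α l))⁻¹ * (exp (k z))⁻¹ = _
    rw [← Complex.exp_neg, ← Complex.exp_neg, ← Complex.exp_add, ← Complex.exp_add,
      Complex.exp_eq_exp_iff_exists_int]
    -- Here `n = 2 Re β(l)`, the integer supplied by half-integrality on the lattice.
    refine ⟨-n, ?_⟩
    have hτ := coe_im_ne_zero τ
    have hl' : conj l = l - 2 * I * τ.im * tauCoord τ l := by rw [← two_im_eq]; ring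
    have e1 : k (z + l) - k z = Real.pi * μ / τ.im * l - 2 * Real.pi * I * conj (β l) := by
      rw [← hβl]; simp only [hk]; ring
    have e2 : conj (β l) = n - β l := by rw [← hre]; ring
    have e3 : k (z + l) + -(2 * Real.pi * I * α l) + -k z =
        (k (z + l) - k z) - 2 * Real.pi * I * α l := by ring
    rw [e3, e1, e2, hαl, hl']
    push_cast
    field_simp
    ring_nf
    simp only [Complex.I_sq, Complex.I_pow_three]
    ring
  rw [he] at h3
  exact h3

theorem phi_mk (μ : ℂ) : phi δ τ (μ : M δ τ) =
    ((ContinuousLinearMap.toSpanSingleton ℂ (e1star τ) μ : ConjDual) : DualTorus δ τ) := rfl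

/-- `φ_{L₀}` is the classifying map `[μ] ↦ T_μ^* L₀ ⊗ L₀^*`. -/
theorem nonempty_iso_translation (m : M δ τ) (α : ConjDual) (h : (α : DualTorus δ τ) = phi δ τ m) :
    Nonempty ((((L0 δ τ).pullback (Torus.translation (lattice δ τ) m)).tensor
      (L0 δ τ).dual).Iso (degreeZeroBundle δ τ α)) := by
  obtain ⟨μ, rfl⟩ := QuotientAddGroup.mk_surjective m
  rw [phi_mk, eq_comm, QuotientAddGroup.eq, neg_add_eq_sub] at h
  have hL := (multipliersL0 δ τ).isFrame_unitAt
  have hT : IsFrame 𝓘(ℂ, ℂ) ((L0 δ τ).pullback (Torus.translation (lattice δ τ) (μ : M δ τ)))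
      (QuotientAddGroup.mk : ℂ → M δ τ) (fun z => (multipliersL0 δ τ).unitAt (z + μ)) :=
    IsFrame.pullback (Torus.contMDiff_mk _)
      (hL.comp (contDiff_id.add contDiff_const).contMDiff)
  -- In the quotient of the factors of `L₀` at `z + μ` and at `z` only `exp(2πi n μ)` survives,
  -- which is the factor of `flatFrame`.
  refine Torus.nonempty_iso (hT.tensor hL.dual) (isFrame_flatFrame δ τ α μ)
    (fun l z => exp (2 * Real.pi * I * tauCoord τ l * μ)) (fun l hl z => ?_)
    (fun l hl z => smulRel_flatFrame δ τ h hl z)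
  have h1 := smulRel_L0 δ τ hl (z + μ)
  rw [show z + μ + l = z + l + μ by ring] at h1
  have h2 := smulRel_L0 δ τ hl z
  have h1' : ((L0 δ τ).pullback (Torus.translation (lattice δ τ) (μ : M δ τ))).SMulRel
      (x := (z : M δ τ)) (x' := ((z + l : ℂ) : M δ τ))
      ((multipliersL0 δ τ).unitAt (z + μ)) ((multipliersL0 δ τ).unitAt (z + l + μ)) _ :=
    SMulRel.pullback h2.proj_eq h1
  have h3 := h1'.tensor (h2.dual (hL.ne_zero _) (hL.ne_zero _))
  have he : ∀ a b : ℂ, exp (2 * Real.pi * I * a * (z + μ) + b) *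
      (exp (2 * Real.pi * I * a * z + b))⁻¹ = exp (2 * Real.pi * I * a * μ) := by
    intro a b
    rw [← Complex.exp_neg, ← Complex.exp_add]
    congr 1
    ring
  rw [he] at h3
  exact h3

end EllipticCurve

/-! ### Products of tori -/

namespace Torus

variable {E E' : Type} [NormedAddCommGroup E] [NormedSpace ℂ E] [NormedAddCommGroup E']
  [NormedSpace ℂ E'] (Λ : AddSubgroup E) [DiscreteTopology Λ] (Λ' : AddSubgroup E')
  [DiscreteTopology Λ']

instance discreteTopology_prod : DiscreteTopology (Λ.prod Λ') := by
  refine DiscreteTopology.of_continuous_injective (β := Λ × Λ')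
    (f := fun p => (⟨p.1.1, p.2.1⟩, ⟨p.1.2, p.2.2⟩)) (by fun_prop) fun p q h => ?_
  rw [Prod.mk_inj, Subtype.mk_eq_mk, Subtype.mk_eq_mk] at h
  exact Subtype.ext (Prod.ext h.1 h.2)

/-- The isomorphism of a product of tori with the quotient of the product. -/
def prodMk : (E ⧸ Λ) × (E' ⧸ Λ') → (E × E') ⧸ Λ.prod Λ' := fun p =>
  Quotient.map₂ (fun v w => (v, w)) (by
    intro v v' h w w' h'
    rw [← Quotient.eq_iff_equiv] at *
    exact QuotientAddGroup.eq.2 ⟨QuotientAddGroup.eq.1 h, QuotientAddGroup.eq.1 h'⟩) p.1 p.2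

theorem prodMk_mk (v : E) (w : E') :
    prodMk Λ Λ' ((v : E ⧸ Λ), (w : E' ⧸ Λ')) = ((v, w) : E × E') := rfl

theorem contMDiff_prodMk :
    ContMDiff (𝓘(ℂ, E).prod 𝓘(ℂ, E')) 𝓘(ℂ, E × E') ω (prodMk Λ Λ') := by
  rintro ⟨x, y⟩
  have hx := (chartAt E x).open_source.mem_nhds (mem_chart_source E x)
  have hy := (chartAt E' y).open_source.mem_nhds (mem_chart_source E' y)
  have h1 : ContMDiffAt 𝓘(ℂ, E) 𝓘(ℂ, E) ω (chartAt E x) x := contMDiffOn_chart.contMDiffAt hx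
  have h2 : ContMDiffAt 𝓘(ℂ, E') 𝓘(ℂ, E') ω (chartAt E' y) y := contMDiffOn_chart.contMDiffAt hy
  have h3 : ContMDiffAt (𝓘(ℂ, E).prod 𝓘(ℂ, E')) 𝓘(ℂ, E × E') ω
      (fun p : (E ⧸ Λ) × (E' ⧸ Λ') => (chartAt E x p.1, chartAt E' y p.2)) (x, y) :=
    (h1.comp (x, y) contMDiffAt_fst).prodMk_space (h2.comp (x, y) contMDiffAt_snd)
  refine ((contMDiff_mk (Λ.prod Λ') _).comp (x, y) h3).congr_of_eventuallyEq ?_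
  filter_upwards [prod_mem_nhds hx hy] with p hp
  have e1 := mk_chart Λ (chart_mem_atlas E x) hp.1
  have e2 := mk_chart Λ' (chart_mem_atlas E' y) hp.2
  rw [Function.comp_apply, ← prodMk_mk, e1, e2]

end Torus

/-! ### Existence of a Poincaré bundle -/

namespace EllipticCurve

open HolLineBundle
open Complex (I exp)

variable (δ : ℕ+) (τ : UpperHalfPlane)

/-- The multipliers `exp (2πi (α(λ) + β(λ) - conj (β(z))))`, for `(λ, β) ∈ Λ × Λ̄^*`, of the
Poincaré bundle. -/
def poincareMultipliers : Torus.Multipliers ((lattice δ τ).prod (dualLattice δ τ)) where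
  e l v := exp (2 * Real.pi * I * (v.2 l.1.1 + l.1.2 l.1.1 - conj (l.1.2 1) * v.1))
  holo l := by
    have h : ContDiff ℂ ω fun v : ℂ × ConjDual => v.2 l.1.1 := by
      have h1 : ∀ α : ConjDual, α l.1.1 =
          (ContinuousLinearMap.apply' ℂ (starRingEnd ℂ) l.1.1 : ConjDual →L[ℂ] ℂ) α := fun _ => rfl
      simp only [h1]
      fun_prop
    exact ContDiff.cexp (by fun_prop)
  ne_zero _ _ := Complex.exp_ne_zero _
  cocycle := by
    rintro ⟨⟨l, β⟩, hl, hβ⟩ ⟨⟨l', β'⟩, hl', hβ'⟩ ⟨z, α⟩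
    obtain ⟨n, hn⟩ := hβ' l hl
    rw [← Complex.exp_add, Complex.exp_eq_exp_iff_exists_int]
    have hre : β' l + conj (β' l) = n := by
      rw [Complex.add_conj, hn]; push_cast; ring
    have hβl : conj (β' 1) * l = conj (β' l) := by
      rw [conjDual_apply β' l]; simp
    -- The exponents in the cocycle relation differ by `2πi (β' l + conj (β' l))`, and `β' l + conj
    -- (β' l) = 2 Re β' l` is an integer.
    refine ⟨n, ?_⟩
    change 2 * Real.pi * I * (α (l + l') + (β (l + l') + β' (l + l')) - conj (β 1 + β' 1) * z) =
      2 * Real.pi * I * ((α l' + β l') + β' l' - conj (β' 1) * (z + l)) +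
        2 * Real.pi * I * (α l + β l - conj (β 1) * z) + n * (2 * Real.pi * I)
    rw [← hre, ← hβl, map_add, map_add, map_add, map_add]
    ring

/-- A Poincaré bundle. -/
def poincareBundle : BundleOnMDual δ τ :=
  (poincareMultipliers δ τ).lineBundle.pullback
    ⟨Torus.prodMk (lattice δ τ) (dualLattice δ τ), Torus.contMDiff_prodMk _ _⟩

theorem isFrame_poincareBundle {F K W : Type} [NormedAddCommGroup F] [NormedSpace ℂ F]
    [TopologicalSpace K] {J : ModelWithCorners ℂ F K} [TopologicalSpace W] [ChartedSpace K W]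
    {f : W → ℂ} {g : W → ConjDual} (hf : ContMDiff J 𝓘(ℂ, ℂ) ω f)
    (hg : ContMDiff J 𝓘(ℂ, ConjDual) ω g) :
    IsFrame J (poincareBundle δ τ) (fun w => ((f w : M δ τ), (g w : DualTorus δ τ)))
      (fun w => (poincareMultipliers δ τ).unitAt (f w, g w)) :=
  IsFrame.pullback (((Torus.contMDiff_mk _).comp hf).prodMk ((Torus.contMDiff_mk _).comp hg))
    ((poincareMultipliers δ τ).isFrame_unitAt.comp (hf.prodMk_space hg))

theorem smulRel_poincareBundle {l : ℂ} (hl : l ∈ lattice δ τ) {β : ConjDual}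
    (hβ : β ∈ dualLattice δ τ) (z : ℂ) (α : ConjDual) :
    (poincareBundle δ τ).SMulRel (x := ((z : M δ τ), (α : DualTorus δ τ)))
      (x' := (((z + l : ℂ) : M δ τ), ((α + β : ConjDual) : DualTorus δ τ)))
      ((poincareMultipliers δ τ).unitAt (z, α)) ((poincareMultipliers δ τ).unitAt (z + l, α + β))
      (exp (2 * Real.pi * I * (α l + β l - conj (β 1) * z)))⁻¹ := by
  have h := (poincareMultipliers δ τ).smulRel_unitAt (l, β) ⟨hl, hβ⟩ (z, α)
  refine SMulRel.pullback ?_ h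
  exact Prod.ext (by rw [eq_comm, QuotientAddGroup.eq]; simpa using hl)
    (by rw [eq_comm, QuotientAddGroup.eq]; simpa using hβ)

/-- For `β = 0` the multiplier is `exp(2πi α(λ))`, that of `P_α`; for `λ = 0` and `z = 0` it is `1`.
-/
theorem isPoincare_poincareBundle : IsPoincare δ τ (poincareBundle δ τ) := by
  constructor
  · intro α
    have hs : IsFrame 𝓘(ℂ, ℂ) ((poincareBundle δ τ).pullback (inclLeft δ τ (α : DualTorus δ τ)))
        (QuotientAddGroup.mk : ℂ → M δ τ)
        (fun z => (poincareMultipliers δ τ).unitAt (z, α)) :=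
      IsFrame.pullback (Torus.contMDiff_mk _)
        (isFrame_poincareBundle δ τ (f := fun z : ℂ => z) (g := fun _ => α) contMDiff_id
          contMDiff_const)
    refine Torus.nonempty_iso hs (flatMultipliers δ τ α).isFrame_unitAt
      (fun l z => (exp (2 * Real.pi * I * α l))⁻¹) (fun l hl z => ?_)
      (fun l hl z => (flatMultipliers δ τ α).smulRel_unitAt l hl z)
    have h := smulRel_poincareBundle δ τ hl (dualLattice δ τ).zero_mem z α
    have h0 : (((z + l : ℂ) : M δ τ)) = (z : M δ τ) := congrArg Prod.fst h.proj_eq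
    have hc : exp (2 * Real.pi * I * (α l + (0 : ConjDual) l - conj ((0 : ConjDual) 1) * z)) =
        exp (2 * Real.pi * I * α l) := by simp
    rw [add_zero, hc] at h
    exact SMulRel.pullback h0 h
  · have hs : IsFrame 𝓘(ℂ, ConjDual) ((poincareBundle δ τ).pullback (inclRight δ τ 0))
        (QuotientAddGroup.mk : ConjDual → DualTorus δ τ)
        (fun β => (poincareMultipliers δ τ).unitAt (0, β)) :=
      IsFrame.pullback (Torus.contMDiff_mk _)
        (isFrame_poincareBundle δ τ (f := fun _ : ConjDual => 0) (g := fun β => β) contMDiff_const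
          contMDiff_id)
    refine Torus.nonempty_iso hs (isFrame_trivial (Torus.contMDiff_mk _)) (fun _ _ => 1)
      (fun β hβ α => ?_) (fun β hβ α => ?_)
    · have h := smulRel_poincareBundle δ τ (lattice δ τ).zero_mem hβ 0 α
      have h0 : (((α + β : ConjDual) : DualTorus δ τ)) = (α : DualTorus δ τ) :=
        congrArg Prod.snd h.proj_eq
      have hc : (exp (2 * Real.pi * I * (α 0 + β 0 - conj (β 1) * 0)))⁻¹ = 1 := by simp
      rw [add_zero, hc] at h
      exact SMulRel.pullback h0 h
    · have h0 : (((α + β : ConjDual) : DualTorus δ τ)) = (α : DualTorus δ τ) := by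
        rw [eq_comm, QuotientAddGroup.eq]; simpa using hβ
      exact smulRel_trivial h0

end EllipticCurve

/-! ### Multipliers of an arbitrary Poincaré bundle and of `K̃` -/

namespace EllipticCurve

open HolLineBundle
open Complex (I exp)

variable (δ : ℕ+) (τ : UpperHalfPlane)

/-- The alternating form of the lattice: `δ` times a determinant of integral coordinates, the
`τ`-components cancelling. It is the compatibility between the factors in the two directions. -/
theorem exists_int_of_mem_lattice {l l' : ℂ} (hl : l ∈ lattice δ τ) (hl' : l' ∈ lattice δ τ) :
    ∃ n : ℤ, tauCoord τ l * l' - tauCoord τ l' * l = n := by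
  obtain ⟨a, b, rfl⟩ := (mem_lattice δ τ).1 hl
  obtain ⟨a', b', rfl⟩ := (mem_lattice δ τ).1 hl'
  have hτ : τ.im ≠ 0 := τ.im_pos.ne'
  refine ⟨(b * a' - b' * a) * (δ : ℕ), ?_⟩
  have e : ∀ a b : ℤ, tauCoord τ (a * (δ : ℂ) + b * (τ : ℂ)) = b := by
    intro a b
    simp [tauCoord, hτ]
  rw [e, e]
  push_cast
  ring

/-- The pullback of a Poincaré bundle to `ℂ × ℂ` has a holomorphic frame with multipliers
`exp (-2πi n μ)` and `exp (-2πi n z)`. -/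
theorem IsPoincare.exists_isFrame {P : BundleOnMDual δ τ} (hP : IsPoincare δ τ P) :
    ∃ s : ∀ w : ℂ × ℂ, P.Fiber (idProdPhi δ τ (projMM δ τ w)),
      IsFrame (𝓘(ℂ, ℂ).prod 𝓘(ℂ, ℂ)) P (fun w => idProdPhi δ τ (projMM δ τ w)) s ∧
      (∀ l ∈ lattice δ τ, ∀ z μ, P.SMulRel (s (z, μ)) (s (z + l, μ))
        (exp (2 * Real.pi * I * tauCoord τ l * μ))) ∧
      ∀ l ∈ lattice δ τ, ∀ z μ, P.SMulRel (s (z, μ)) (s (z, μ + l))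
        (exp (2 * Real.pi * I * tauCoord τ l * z)) := by
  let T : ℂ →L[ℂ] ConjDual := ContinuousLinearMap.toSpanSingleton ℂ (e1star τ)
  let φ := fun α => (hP.1 α).some
  let ψ := hP.2.some
  -- The isomorphisms `φ (T μ)` are chosen independently for different `μ`, so `t μ z` need not even
  -- be continuous in `μ`.
  let t : ∀ μ z : ℂ, P.Fiber ((z : M δ τ), (T μ : DualTorus δ τ)) := fun μ z =>
    ((φ (T μ)).fiberEquiv (z : M δ τ)).symm (flatFrame δ τ (T μ) μ z)
  have ht : ∀ μ, IsFrame 𝓘(ℂ, ℂ) P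
      (fun z : ℂ => ((z : M δ τ), (T μ : DualTorus δ τ))) (t μ) :=
    fun μ => ((isFrame_flatFrame δ τ (T μ) μ).iso_symm (φ (T μ))).of_pullback
  have htper : ∀ l ∈ lattice δ τ, ∀ z μ, P.SMulRel (t μ z) (t μ (z + l))
      (exp (2 * Real.pi * I * tauCoord τ l * μ)) := fun l hl z μ =>
    ((smulRel_flatFrame δ τ (by rw [sub_self]; exact zero_mem _) hl z).iso_symm
      (φ (T μ))).of_pullback
  let b : ∀ ξ : DualTorus δ τ, P.Fiber ((0 : M δ τ), ξ) := fun ξ =>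
    (ψ.fiberEquiv ξ).symm (1 : ℂ)
  have hb : IsFrame 𝓘(ℂ, ConjDual) P (fun ξ => ((0 : M δ τ), ξ)) b :=
    ((isFrame_trivial contMDiff_id).iso_symm ψ).of_pullback
  -- Scaling by `k μ` makes the slice frame agree at `z = 0` with the frame `b`, which is
  -- holomorphic in the parameter.
  have hk : ∀ μ, ∃ k, P.SMulRel (t μ 0) (b (T μ : DualTorus δ τ)) k := fun μ =>
    exists_smulRel rfl ((ht μ).ne_zero 0) _
  choose k hk using hk
  have hk0 : ∀ μ, k μ ≠ 0 := by
    intro μ h0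
    have h := smulRel_iff.1 (hk μ)
    rw [h0, zero_smul] at h
    exact hb.ne_zero _ h
  let Φ : ℂ × ℂ → M δ τ × DualTorus δ τ := fun w => idProdPhi δ τ (projMM δ τ w)
  have hΦ : ContMDiff (𝓘(ℂ, ℂ).prod 𝓘(ℂ, ℂ)) (𝓘(ℂ, ℂ).prod 𝓘(ℂ, ConjDual)) ω Φ :=
    (idProdPhi δ τ).contMDiff.comp (projMM δ τ).contMDiff
  let s : ∀ w : ℂ × ℂ, P.Fiber (Φ w) := fun w => k w.2 • t w.2 w.1
  have hslice : ∀ μ, IsFrame 𝓘(ℂ, ℂ) P (fun z => Φ (z, μ)) (fun z => s (z, μ)) := fun μ =>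
    (ht μ).smul (c := fun _ => k μ) contMDiff_const (fun _ => hk0 μ)
  have hs0 : ∀ μ, s (0, μ) = b (T μ : DualTorus δ τ) := fun μ => (smulRel_iff.1 (hk μ)).symm
  have hbase : IsFrame 𝓘(ℂ, ℂ) P (fun μ => Φ (0, μ)) (fun μ => s (0, μ)) := by
    simp only [hs0]
    exact hb.comp ((Torus.contMDiff_mk (dualLattice δ τ)).comp T.contDiff.contMDiff)
  have hper : ∀ l ∈ lattice δ τ, ∀ z μ, P.SMulRel (s (z, μ)) (s (z + l, μ))
      (exp (2 * Real.pi * I * tauCoord τ l * μ)) := by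
    intro l hl z μ
    have h1 : P.SMulRel (t μ z) (s (z, μ)) (k μ) := smulRel_smul _ _
    have h2 : P.SMulRel (t μ (z + l)) (s (z + l, μ)) (k μ) := smulRel_smul _ _
    have h3 := ((h1.symm (hk0 μ)).trans (htper l hl z μ)).trans h2
    rwa [mul_comm (exp _), mul_inv_cancel_left₀ (hk0 μ)] at h3
  refine ⟨s, isFrame_of_slices (isCobounded_lattice δ τ) hΦ hslice hbase
    (χ := fun l μ => exp (2 * Real.pi * I * tauCoord τ l * μ))
    (fun l _ => ContDiff.cexp (by fun_prop)) hper, hper, fun l hl z μ => ?_⟩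
  have hΦl : ∀ z, Φ (z, μ + l) = Φ (z, μ) := by
    intro z
    refine Prod.ext rfl ?_
    change ((T (μ + l) : ConjDual) : DualTorus δ τ) = (T μ : ConjDual)
    rw [eq_comm, QuotientAddGroup.eq, map_add, neg_add_cancel_left]
    exact smul_e1star_mem δ τ l hl
  have hex : ∀ z, ∃ c, P.SMulRel (s (z, μ)) (s (z, μ + l)) c := fun z =>
    exists_smulRel (hΦl z) ((hslice μ).ne_zero z) _
  choose c hc using hex
  have hcd : ContDiff ℂ ω c := contMDiff_iff_contDiff.1
    ((hslice μ).contMDiff_of_smulRel (hslice (μ + l)) hc)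
  -- Along `z = 0` the frame is pulled back from `M̂`, hence invariant under lattice translations of
  -- `μ`.
  have hc0 : c 0 = 1 := by
    refine (hc 0).unique ?_ ((hslice μ).ne_zero 0)
    rw [hs0, hs0]
    have h : ((T (μ + l) : ConjDual) : DualTorus δ τ) = (T μ : ConjDual) :=
      congrArg Prod.snd (hΦl 0)
    change (⟨_, b ((T (μ + l) : ConjDual) : DualTorus δ τ)⟩ : P.Tot) =
      ⟨_, (1 : ℂ) • b ((T μ : ConjDual) : DualTorus δ τ)⟩
    rw [h, one_smul]
  -- Translating by `l'` in `z` and by `l` in `μ`, in either order, gives the same vector; the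
  -- factor in `z` is `exp(2πi n' μ)` before and `exp(2πi n' (μ + l))` after the translation of `μ`,
  -- with `n'` the coordinate of `l'`.
  have hcper : ∀ l' ∈ lattice δ τ, ∀ z, c (z + l') =
      exp (2 * Real.pi * I * tauCoord τ l' * l) * c z := by
    intro l' hl' z
    have h1 := (hper l' hl' z μ).trans (hc (z + l'))
    have h2 := (hc z).trans (hper l' hl' z (μ + l))
    have h3 := h1.unique h2 ((hslice μ).ne_zero z)
    rw [mul_add (2 * Real.pi * I * tauCoord τ l'), Complex.exp_add, mul_comm,
      mul_assoc (exp _)] at h3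
    exact mul_left_cancel₀ (Complex.exp_ne_zero _) h3
  -- After division by `exp(2πi n z)`, the factor picked up under `l'` is `exp(2πi (n' l - n l')) =
  -- 1`; the quotient is periodic and entire, so it equals its value `1` at `0`.
  have hconst := (isCobounded_lattice δ τ).eq_of_periodic
    (H := fun z => exp (-(2 * Real.pi * I * tauCoord τ l * z)) * c z)
    (((by fun_prop : Differentiable ℂ fun z : ℂ =>
      -(2 * Real.pi * I * tauCoord τ l * z)).cexp).mul (hcd.differentiable (by simp)))
    (fun l' hl' z => by
      obtain ⟨n, hn⟩ := exists_int_of_mem_lattice δ τ hl' hl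
      rw [hcper l' hl', ← mul_assoc, ← Complex.exp_add]
      congr 1
      rw [Complex.exp_eq_exp_iff_exists_int]
      refine ⟨n, ?_⟩
      rw [← hn]
      ring) z 0
  simp only [mul_zero, neg_zero, Complex.exp_zero, hc0, one_mul] at hconst
  have hcz : c z = exp (2 * Real.pi * I * tauCoord τ l * z) := by
    rw [Complex.exp_neg, inv_mul_eq_one₀ (Complex.exp_ne_zero _)] at hconst
    exact hconst.symm
  rw [← hcz]
  exact hc z

/-- Factors multiply under tensor products: in the direction of `z` the second copy of `L₀`
contributes `1`, in the direction of `μ` the first does. The coordinate `n` is `0` for `δ` and `1`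
for `τ`. -/
theorem IsPoincare.hasMultipliers {P : BundleOnMDual δ τ} (hP : IsPoincare δ τ P) :
    (KTilde δ τ P).HasMultipliers (projMM δ τ) (gens δ τ)
        ![fun _ => 1,
          fun w => exp (-2 * Real.pi * I * w.1 - 2 * Real.pi * I * w.2 - Real.pi * I * τ),
          fun _ => 1,
          fun w => exp (-2 * Real.pi * I * w.1 - 2 * Real.pi * I * w.2 - Real.pi * I * τ)] ∧
      (P.pullback (idProdPhi δ τ)).HasMultipliers (projMM δ τ) (gens δ τ)
        ![fun _ => 1, fun w => exp (-2 * Real.pi * I * w.2),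
          fun _ => 1, fun w => exp (-2 * Real.pi * I * w.1)] := by
  obtain ⟨s, hs, h₁, h₂⟩ := hP.exists_isFrame
  have hp : ContMDiff (𝓘(ℂ, ℂ).prod 𝓘(ℂ, ℂ)) (𝓘(ℂ, ℂ).prod 𝓘(ℂ, ℂ)) ω (projMM δ τ) :=
    (projMM δ τ).contMDiff
  have hP' : IsFrame (𝓘(ℂ, ℂ).prod 𝓘(ℂ, ℂ)) (P.pullback (idProdPhi δ τ)) (projMM δ τ) s :=
    IsFrame.pullback hp hs
  let F₁ : BundleOnMM δ τ := (L0 δ τ).pullback ContMDiffMap.fst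
  let F₂ : BundleOnMM δ τ := (L0 δ τ).pullback ContMDiffMap.snd
  let u := (multipliersL0 δ τ).unitAt
  have hu := (multipliersL0 δ τ).isFrame_unitAt
  have hF : IsFrame (𝓘(ℂ, ℂ).prod 𝓘(ℂ, ℂ)) F₁ (projMM δ τ)
      (fun w => u w.1) := IsFrame.pullback hp (hu.comp contMDiff_fst)
  have hS : IsFrame (𝓘(ℂ, ℂ).prod 𝓘(ℂ, ℂ)) F₂ (projMM δ τ)
      (fun w => u w.2) := IsFrame.pullback hp (hu.comp contMDiff_snd)
  have hK : IsFrame (𝓘(ℂ, ℂ).prod 𝓘(ℂ, ℂ)) (KTilde δ τ P) (projMM δ τ)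
      (fun w => (u w.1 ⊗ₜ[ℂ] s w) ⊗ₜ[ℂ] u w.2) := (hF.tensor hP').tensor hS
  have hper : ∀ l ∈ lattice δ τ, ∀ v : ℂ, ((v + l : ℂ) : M δ τ) = v := fun l hl v =>
    (smulRel_L0 δ τ hl v).proj_eq
  have hpz : ∀ l ∈ lattice δ τ, ∀ z μ, projMM δ τ (z + l, μ) = projMM δ τ (z, μ) :=
    fun l hl z μ => Prod.ext (hper l hl z) rfl
  have hpμ : ∀ l ∈ lattice δ τ, ∀ z μ, projMM δ τ (z, μ + l) = projMM δ τ (z, μ) :=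
    fun l hl z μ => Prod.ext rfl (hper l hl μ)
  have hPz : ∀ l ∈ lattice δ τ, ∀ z μ, (P.pullback (idProdPhi δ τ)).SMulRel (s (z, μ))
      (s (z + l, μ)) (exp (2 * Real.pi * I * tauCoord τ l * μ)) := fun l hl z μ =>
    (h₁ l hl z μ).pullback (hpz l hl z μ)
  have hPμ : ∀ l ∈ lattice δ τ, ∀ z μ, (P.pullback (idProdPhi δ τ)).SMulRel (s (z, μ))
      (s (z, μ + l)) (exp (2 * Real.pi * I * tauCoord τ l * z)) := fun l hl z μ =>
    (h₂ l hl z μ).pullback (hpμ l hl z μ)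
  let σ : ∀ w, (KTilde δ τ P).Fiber (projMM δ τ w) := fun w => (u w.1 ⊗ₜ[ℂ] s w) ⊗ₜ[ℂ] u w.2
  have hKz : ∀ l ∈ lattice δ τ, ∀ z μ, (KTilde δ τ P).SMulRel (σ (z, μ)) (σ (z + l, μ))
      (exp (2 * Real.pi * I * tauCoord τ l * z + Real.pi * I * tauCoord τ l ^ 2 * τ) *
        exp (2 * Real.pi * I * tauCoord τ l * μ) * 1) := by
    intro l hl z μ
    have e1 : F₁.SMulRel (x := projMM δ τ (z, μ))
        (x' := projMM δ τ (z + l, μ)) (u z) (u (z + l)) _ :=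
      SMulRel.pullback (hpz l hl z μ) (smulRel_L0 δ τ hl z)
    have e2 : F₂.SMulRel (x := projMM δ τ (z, μ))
        (x' := projMM δ τ (z + l, μ)) (u μ) (u μ) 1 :=
      SMulRel.pullback (hpz l hl z μ) (smulRel_iff.2 (one_smul ℂ _).symm)
    exact (e1.tensor (hPz l hl z μ)).tensor e2
  have hKμ : ∀ l ∈ lattice δ τ, ∀ z μ, (KTilde δ τ P).SMulRel (σ (z, μ)) (σ (z, μ + l))
      (1 * exp (2 * Real.pi * I * tauCoord τ l * z) *
        exp (2 * Real.pi * I * tauCoord τ l * μ + Real.pi * I * tauCoord τ l ^ 2 * τ)) := by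
    intro l hl z μ
    have e1 : F₁.SMulRel (x := projMM δ τ (z, μ))
        (x' := projMM δ τ (z, μ + l)) (u z) (u z) 1 :=
      SMulRel.pullback (hpμ l hl z μ) (smulRel_iff.2 (one_smul ℂ _).symm)
    have e2 : F₂.SMulRel (x := projMM δ τ (z, μ))
        (x' := projMM δ τ (z, μ + l)) (u μ) (u (μ + l)) _ :=
      SMulRel.pullback (hpμ l hl z μ) (smulRel_L0 δ τ hl μ)
    exact (e1.tensor (hPμ l hl z μ)).tensor e2
  have hg : ∀ z μ : ℂ, (z, μ) + gens δ τ 0 = (z + (δ : ℂ), μ) ∧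
      (z, μ) + gens δ τ 1 = (z + (τ : ℂ), μ) ∧ (z, μ) + gens δ τ 2 = (z, μ + (δ : ℂ)) ∧
      (z, μ) + gens δ τ 3 = (z, μ + (τ : ℂ)) := fun z μ => by simp [gens]
  -- Passes from the factor `c` of the frame to the multiplier `d = c⁻¹`.
  have hmul : ∀ (Q : BundleOnMM δ τ) (t : ∀ w, Q.Fiber (projMM δ τ w)) (w w' : ℂ × ℂ) (c d : ℂ)
      (v : ℂ × ℂ), v = w' → Q.SMulRel (t w) (t w') c → c * d = 1 → Q.SMulRel (t v) (t w) d := by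
    rintro Q t w w' c d _ rfl h hcd
    rw [eq_inv_of_mul_eq_one_right hcd]
    exact h.symm (left_ne_zero_of_mul_eq_one hcd)
  constructor
  · refine hK.hasMultipliers fun k w => ?_
    obtain ⟨z, μ⟩ := w
    obtain ⟨g0, g1, g2, g3⟩ := hg z μ
    fin_cases k
    · refine hmul _ σ _ _ _ _ _ g0 (hKz _ (delta_mem δ τ) z μ) ?_
      simp [tauCoord_delta]
    · refine hmul _ σ _ _ _ _ _ g1 (hKz _ (tau_mem δ τ) z μ) ?_
      simp only [tauCoord_tau]
      rw [mul_one, ← Complex.exp_add]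
      refine (Complex.exp_add _ _).symm.trans (Complex.exp_eq_one_iff.2 ⟨0, ?_⟩)
      push_cast
      ring
    · refine hmul _ σ _ _ _ _ _ g2 (hKμ _ (delta_mem δ τ) z μ) ?_
      simp [tauCoord_delta]
    · refine hmul _ σ _ _ _ _ _ g3 (hKμ _ (tau_mem δ τ) z μ) ?_
      simp only [tauCoord_tau]
      rw [one_mul, ← Complex.exp_add]
      refine (Complex.exp_add _ _).symm.trans (Complex.exp_eq_one_iff.2 ⟨0, ?_⟩)
      push_cast
      ring
  · refine hP'.hasMultipliers fun k w => ?_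
    obtain ⟨z, μ⟩ := w
    obtain ⟨g0, g1, g2, g3⟩ := hg z μ
    fin_cases k
    · refine hmul (P.pullback (idProdPhi δ τ)) s (z, μ) _ _ _ _ g0 (hPz _ (delta_mem δ τ) z μ) ?_
      simp [tauCoord_delta]
    · refine hmul (P.pullback (idProdPhi δ τ)) s (z, μ) _ _ _ _ g1 (hPz _ (tau_mem δ τ) z μ) ?_
      simp only [tauCoord_tau]
      refine (Complex.exp_add _ _).symm.trans (Complex.exp_eq_one_iff.2 ⟨0, ?_⟩)
      push_cast
      ring
    · refine hmul (P.pullback (idProdPhi δ τ)) s (z, μ) _ _ _ _ g2 (hPμ _ (delta_mem δ τ) z μ) ?_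
      simp [tauCoord_delta]
    · refine hmul (P.pullback (idProdPhi δ τ)) s (z, μ) _ _ _ _ g3 (hPμ _ (tau_mem δ τ) z μ) ?_
      simp only [tauCoord_tau]
      refine (Complex.exp_add _ _).symm.trans (Complex.exp_eq_one_iff.2 ⟨0, ?_⟩)
      push_cast
      ring

end EllipticCurve

end

theorem mainTheorem8 (δ : ℕ+) (τ : UpperHalfPlane) :
    (∀ (m : EllipticCurve.M δ τ) (α : EllipticCurve.ConjDual),
      (α : EllipticCurve.DualTorus δ τ) = EllipticCurve.phi δ τ m →
        Nonempty ((((EllipticCurve.L0 δ τ).pullback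
          (Torus.translation (EllipticCurve.lattice δ τ) m)).tensor
            (EllipticCurve.L0 δ τ).dual).Iso (EllipticCurve.degreeZeroBundle δ τ α))) ∧
    (∃ P : EllipticCurve.BundleOnMDual δ τ, EllipticCurve.IsPoincare δ τ P) ∧
    ∀ P : EllipticCurve.BundleOnMDual δ τ, EllipticCurve.IsPoincare δ τ P →
      (EllipticCurve.KTilde δ τ P).HasMultipliers (EllipticCurve.projMM δ τ)
        (EllipticCurve.gens δ τ)
        ![fun _ => 1,
          fun w => Complex.exp (-2 * Real.pi * Complex.I * w.1 - 2 * Real.pi * Complex.I * w.2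
            - Real.pi * Complex.I * τ),
          fun _ => 1,
          fun w => Complex.exp (-2 * Real.pi * Complex.I * w.1 - 2 * Real.pi * Complex.I * w.2
            - Real.pi * Complex.I * τ)] ∧
      (P.pullback (EllipticCurve.idProdPhi δ τ)).HasMultipliers (EllipticCurve.projMM δ τ)
        (EllipticCurve.gens δ τ)
        ![fun _ => 1,
          fun w => Complex.exp (-2 * Real.pi * Complex.I * w.2),
          fun _ => 1,
          fun w => Complex.exp (-2 * Real.pi * Complex.I * w.1)] :=
  ⟨EllipticCurve.nonempty_iso_translation δ τ,
    ⟨EllipticCurve.poincareBundle δ τ, EllipticCurve.isPoincare_poincareBundle δ τ⟩,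
    fun _ hP => EllipticCurve.IsPoincare.hasMultipliers δ τ hP⟩
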